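/- Let $\mathbb D=\{z\in\mathbb C:|z|<1\}$ and $\mathbb T=\{z\in\mathbb C:|z|=1\}$, and for a nonempty finite set $B\subset\mathbb T$ let $\operatorname{dist}(z,B)=\min_{b\in B}|z-b|$. Let $E,F\subset\mathbb T$ be nonempty, finite and disjoint, let $p,q,r\ge 0$ be real numbers, and let $\varepsilon>0$. Then there is a positive number $C=C(E,F,p,q,r,\varepsilon)$ such that the following holds. For every $K>0$ and every analytic function $f$ on $\mathbb D$ with $|f(0)|=1$ and $$\log|f(z)|\le \frac{K}{(1-|z|)^p}\,\frac{\operatorname{dist}^r(z,E)}{\operatorname{dist}^q(z,F)},\qquad z\in\mathbb D,$$ one has $$\sum_{\zeta\in Z(f)}(1-|\zeta|)^{p+1+\varepsilon}\,\frac{\operatorname{dist}^{(q-1+\varepsilon)_+}(\zeta,F)}{\operatorname{dist}^{\min(p,r)}(\zeta,E)}\le C\cdot K,$$ where $Z(f)$ is the set of zeros of $f$ in $\mathbb D$, each zero being repeated in the sum according to its multiplicity, and $a_+=\max(a,0)$. -/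

import Mathlib

open scoped ENNReal

/-- The zero set in the open unit disk of a function `f`, as a set of points. -/
def diskZeros (f : ℂ → ℂ) : Set ℂ := {ζ | ζ ∈ Metric.ball (0 : ℂ) 1 ∧ f ζ = 0}

/-- The sum, with values in `[0, ∞]`, of a weight `w` over the zeros of `f` in the open unit disk,
each zero being counted with its multiplicity (the order of vanishing of `f` there). -/
noncomputable def sumOverZeros (f : ℂ → ℂ) (w : ℂ → ℝ) : ℝ≥0∞ :=
  ∑' ζ : diskZeros f, (analyticOrderAt f (ζ : ℂ) : ℝ≥0∞) * ENNReal.ofReal (w ζ)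

/-!
The idea is potential-theoretic. For a nonnegative `C²` function `φ` compactly supported in the
disc, Riesz's formula gives `2π ∑ φ(ζ) = ∫ log |f| Δφ`, the sum running over the zeros with
multiplicity. Suppose `φ` is comparable to the weight of the theorem and `Δφ ≥ 0` outside a disc
`|z| ≤ R < 1`. Then outside that disc `log |f|` may be replaced by its upper bound, and inside it
the negative part of `log |f|` is controlled by the positive part, because `|f 0| = 1` and
Jensen's inequality make all circular means of `log |f|` nonnegative
(`integral_smoothLog_mul_planeLaplacian_le`). So the sum is at most `∫ M W`, where `M` is the
growth bound and `W` a multiple of the bound for `|Δφ|`, and this is linear in `K`.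

The logarithm is smoothed to `½ log (|f|² + d²)`, for which Green's identity is elementary. As
`d → 0` its Laplacian concentrates at the zeros; rescaling around each zero and Fatou's lemma recover
mass at least `2π` times the multiplicity, which is the half of Riesz's formula that is needed
(`sum_zeros_le_of_integral_smoothLog_le`).

For a single point `e` of `E`, with `r ≤ p`, `ε ≤ 1` and `a = p + 1 + ε`, the test function is, up
to a cutoff at height `t` above the circle, `φ = (1 - |z|²) ^ a * ∏ |z - b| ^ c * D ^ (-r)`, with
`D = |z - e| + B (1 - |z|²)`. With `|z - e|` in place of `D` it need not be subharmonic near `e`.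
The function `D` is comparable to `|z - e|`, but for large `B` it is close to `B (1 - |z|²)` on
radial approach to `e`, where `φ` then behaves like the convex power `(1 - |z|²) ^ (a - r)`, with
`a - r ≥ 1 + ε`. The product over `F` is log-harmonic and does no harm. Hence `Δφ ≥ 0` near the
circle, and `|Δφ|` is at most a constant times the displayed product divided by `(1 - |z|²)²`,
uniformly in `t` (`exists_testFunction_bounds`). The exponents are such that `M W` is at most a
constant times `K` times a sum of the singularities `(1 - |z|²) ^ (ε - 1) |z - b| ^ (ε - 1)`,
which are integrable over the disc (`growth_mul_exp_logWeight_le`,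
`integrableOn_rpow_mul_rpow_norm_sub`).

The case of general `E`, `r` and `ε` reduces to this one: `dist(z, E)` is at most the distance to
any point of `E` and equal to one of them, so the growth bound holds for each point separately and
the weight is at most the sum of the single-point weights; and lowering `r` to `min p r` and `ε`
to `min ε 1` costs only constants.
-/

/-! ### Calculus of the Laplacian in the plane -/

/-- The derivative of `φ : ℂ → ℝ` in the direction `v`, as a function of the point. -/
noncomputable def dirDeriv (v : ℂ) (φ : ℂ → ℝ) (z : ℂ) : ℝ := fderiv ℝ φ z v

/-- The Laplacian of a real function on the plane, as the sum of the second directional derivatives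
along `1` and `I`. -/
noncomputable def planeLaplacian (φ : ℂ → ℝ) (z : ℂ) : ℝ :=
  dirDeriv 1 (dirDeriv 1 φ) z + dirDeriv Complex.I (dirDeriv Complex.I φ) z

theorem ContDiffAt.dirDeriv {φ : ℂ → ℝ} {z : ℂ} (h : ContDiffAt ℝ 2 φ z) (v : ℂ) :
    ContDiffAt ℝ 1 (dirDeriv v φ) z := by
  have := h.fderiv_right (m := 1) (by norm_num)
  exact this.clm_apply contDiffAt_const

theorem ContDiffAt.eventually_two {φ : ℂ → ℝ} {z : ℂ} (h : ContDiffAt ℝ 2 φ z) :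
    ∀ᶠ w in nhds z, ContDiffAt ℝ 2 φ w :=
  h.eventually (by simp)

theorem ContDiffAt.planeLaplacian {φ : ℂ → ℝ} {z : ℂ} (h : ContDiffAt ℝ 2 φ z) :
    ContinuousAt (planeLaplacian φ) z := by
  have key : ∀ v, ContinuousAt (_root_.dirDeriv v (_root_.dirDeriv v φ)) z := fun v => by
    have := (h.dirDeriv v).fderiv_right (m := 0) (by norm_num)
    exact (this.clm_apply contDiffAt_const).continuousAt
  exact (key 1).add (key Complex.I)

theorem dirDeriv_congr {φ ψ : ℂ → ℝ} {z : ℂ} (h : φ =ᶠ[nhds z] ψ) (v : ℂ) :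
    dirDeriv v φ =ᶠ[nhds z] dirDeriv v ψ := by
  filter_upwards [h.fderiv (𝕜 := ℝ)] with w hw
  simp only [dirDeriv, hw]

theorem planeLaplacian_congr {φ ψ : ℂ → ℝ} {z : ℂ} (h : φ =ᶠ[nhds z] ψ) :
    planeLaplacian φ z = planeLaplacian ψ z := by
  unfold planeLaplacian
  rw [(dirDeriv_congr (dirDeriv_congr h 1) 1).eq_of_nhds,
    (dirDeriv_congr (dirDeriv_congr h Complex.I) Complex.I).eq_of_nhds]

/-- `HasJet φ z g l` says that `φ` is twice continuously differentiable at `z`, with gradient `g`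
(a complex number, read as a vector of the plane) and Laplacian `l`. -/
structure HasJet (φ : ℂ → ℝ) (z g : ℂ) (l : ℝ) : Prop where
  contDiffAt : ContDiffAt ℝ 2 φ z
  re : dirDeriv 1 φ z = g.re
  im : dirDeriv Complex.I φ z = g.im
  lap : planeLaplacian φ z = l

namespace HasJet

variable {φ ψ : ℂ → ℝ} {z g h : ℂ} {k l : ℝ}

theorem congr (H : HasJet φ z g l) (e : ψ =ᶠ[nhds z] φ) : HasJet ψ z g l :=
  ⟨H.contDiffAt.congr_of_eventuallyEq e, (dirDeriv_congr e 1).eq_of_nhds.trans H.re,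
    (dirDeriv_congr e Complex.I).eq_of_nhds.trans H.im, (planeLaplacian_congr e).trans H.lap⟩

theorem congr_val (H : HasJet φ z g l) {g' : ℂ} {l' : ℝ} (e : g = g') (e' : l = l') :
    HasJet φ z g' l' := e ▸ e' ▸ H

theorem const (c : ℝ) : HasJet (fun _ => c) z 0 0 := by
  have h : ∀ v, dirDeriv v (fun _ : ℂ => c) = fun _ => 0 := fun v => by
    ext w; simp [dirDeriv]
  have h' : ∀ v, dirDeriv v (fun _ : ℂ => (0 : ℝ)) = fun _ => 0 := fun v => by
    ext w; simp [dirDeriv]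
  refine ⟨contDiffAt_const, by simp [h], by simp [h], by simp [planeLaplacian, h, h']⟩

theorem add (H : HasJet φ z g l) (K : HasJet ψ z h k) :
    HasJet (fun w => φ w + ψ w) z (g + h) (l + k) := by
  have e : ∀ v, dirDeriv v (fun w => φ w + ψ w) =ᶠ[nhds z]
      fun w => dirDeriv v φ w + dirDeriv v ψ w := fun v => by
    filter_upwards [H.contDiffAt.eventually_two, K.contDiffAt.eventually_two] with w h1 h2
    simp only [dirDeriv]
    rw [fderiv_fun_add (h1.differentiableAt (by norm_num)) (h2.differentiableAt (by norm_num))]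
    rfl
  have e2 : ∀ v, dirDeriv v (dirDeriv v (fun w => φ w + ψ w)) z =
      dirDeriv v (dirDeriv v φ) z + dirDeriv v (dirDeriv v ψ) z := fun v => by
    rw [(dirDeriv_congr (e v) v).eq_of_nhds, dirDeriv,
      fderiv_fun_add ((H.contDiffAt.dirDeriv v).differentiableAt (by norm_num))
        ((K.contDiffAt.dirDeriv v).differentiableAt (by norm_num))]
    rfl
  refine ⟨H.contDiffAt.add K.contDiffAt, ?_, ?_, ?_⟩
  · rw [(e 1).eq_of_nhds, H.re, K.re, Complex.add_re]
  · rw [(e Complex.I).eq_of_nhds, H.im, K.im, Complex.add_im]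
  · rw [planeLaplacian, e2, e2, ← H.lap, ← K.lap, planeLaplacian, planeLaplacian]; ring

/-- Chain rule: `Δ(χ ∘ φ) = χ'(φ) Δφ + χ''(φ) |∇φ|²`. -/
theorem comp (H : HasJet φ z g l) {χ : ℝ → ℝ} (hχ : ContDiffAt ℝ 2 χ (φ z)) :
    HasJet (fun w => χ (φ w)) z (deriv χ (φ z) * g)
      (deriv χ (φ z) * l + deriv (deriv χ) (φ z) * ‖g‖ ^ 2) := by
  have hφc := H.contDiffAt.continuousAt
  have e : ∀ v, dirDeriv v (fun w => χ (φ w)) =ᶠ[nhds z]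
      fun w => deriv χ (φ w) * dirDeriv v φ w := fun v => by
    filter_upwards [H.contDiffAt.eventually_two,
      hφc.eventually (hχ.eventually (by simp))] with w h1 h2
    have := (h2.differentiableAt (by norm_num)).hasDerivAt.comp_hasFDerivAt w
      (h1.differentiableAt (by norm_num)).hasFDerivAt
    simp only [dirDeriv]
    rw [show (fun w => χ (φ w)) = χ ∘ φ from rfl, this.fderiv]
    simp
  have hd : DifferentiableAt ℝ (deriv χ) (φ z) := by
    have : ContDiffAt ℝ 1 (deriv χ) (φ z) := by
      have := hχ.fderiv_right (m := 1) (by norm_num)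
      exact this.clm_apply contDiffAt_const
    exact this.differentiableAt (by norm_num)
  have e2 : ∀ v, dirDeriv v (dirDeriv v (fun w => χ (φ w))) z =
      deriv χ (φ z) * dirDeriv v (dirDeriv v φ) z
        + deriv (deriv χ) (φ z) * dirDeriv v φ z ^ 2 := fun v => by
    have h1 := hd.hasDerivAt.comp_hasFDerivAt z
      (H.contDiffAt.differentiableAt (by norm_num)).hasFDerivAt
    have h2 := ((H.contDiffAt.dirDeriv v).differentiableAt (by norm_num)).hasFDerivAt
    have h3 := h1.mul h2
    rw [(dirDeriv_congr (e v) v).eq_of_nhds, dirDeriv]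
    rw [show (fun w => deriv χ (φ w) * dirDeriv v φ w) = (deriv χ ∘ φ) * dirDeriv v φ from rfl,
      h3.fderiv]
    simp [dirDeriv]; ring
  refine ⟨hχ.comp z H.contDiffAt, ?_, ?_, ?_⟩
  · rw [(e 1).eq_of_nhds, H.re]; simp
  · rw [(e Complex.I).eq_of_nhds, H.im]; simp
  · rw [planeLaplacian, e2, e2, ← H.lap, planeLaplacian, H.re, H.im, ← Complex.normSq_eq_norm_sq,
      Complex.normSq_apply]; ring

/-- Leibniz rule for the Laplacian of a product. -/
theorem mul (H : HasJet φ z g l) (K : HasJet ψ z h k) :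
    HasJet (fun w => φ w * ψ w) z (φ z * h + ψ z * g)
      (φ z * k + ψ z * l + 2 * (g.re * h.re + g.im * h.im)) := by
  have e : ∀ v, dirDeriv v (fun w => φ w * ψ w) =ᶠ[nhds z]
      fun w => φ w * dirDeriv v ψ w + ψ w * dirDeriv v φ w := fun v => by
    filter_upwards [H.contDiffAt.eventually_two, K.contDiffAt.eventually_two] with w h1 h2
    simp only [dirDeriv]
    rw [fderiv_fun_mul (h1.differentiableAt (by norm_num)) (h2.differentiableAt (by norm_num))]
    rfl
  have e2 : ∀ v, dirDeriv v (dirDeriv v (fun w => φ w * ψ w)) z =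
      φ z * dirDeriv v (dirDeriv v ψ) z + ψ z * dirDeriv v (dirDeriv v φ) z
        + 2 * (dirDeriv v φ z * dirDeriv v ψ z) := fun v => by
    have h1 := (H.contDiffAt.differentiableAt (by norm_num)).hasFDerivAt
    have h2 := (K.contDiffAt.differentiableAt (by norm_num)).hasFDerivAt
    have h1' := ((H.contDiffAt.dirDeriv v).differentiableAt (by norm_num)).hasFDerivAt
    have h2' := ((K.contDiffAt.dirDeriv v).differentiableAt (by norm_num)).hasFDerivAt
    have h3 := (h1.fun_mul h2').fun_add (h2.fun_mul h1')
    rw [(dirDeriv_congr (e v) v).eq_of_nhds, dirDeriv, h3.fderiv]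
    simp only [add_apply, smul_apply, smul_eq_mul, dirDeriv]
    ring
  refine ⟨H.contDiffAt.mul K.contDiffAt, ?_, ?_, ?_⟩
  · rw [(e 1).eq_of_nhds, H.re, K.re]; simp
  · rw [(e Complex.I).eq_of_nhds, H.im, K.im]; simp
  · rw [planeLaplacian, e2, e2, ← H.lap, ← K.lap, planeLaplacian, planeLaplacian, H.re, H.im,
      K.re, K.im]; ring

theorem const_mul (H : HasJet φ z g l) (c : ℝ) : HasJet (fun w => c * φ w) z (c * g) (c * l) := by
  have hd : deriv (fun x : ℝ => c * x) = fun _ => c := by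
    ext x; simp
  have := H.comp (χ := fun x => c * x) (by fun_prop)
  refine this.congr_val ?_ ?_ <;> simp [hd]

theorem sum {ι : Type*} (s : Finset ι) {φ : ι → ℂ → ℝ} {g : ι → ℂ} {l : ι → ℝ}
    (H : ∀ i ∈ s, HasJet (φ i) z (g i) (l i)) :
    HasJet (fun w => ∑ i ∈ s, φ i w) z (∑ i ∈ s, g i) (∑ i ∈ s, l i) := by
  classical
  induction s using Finset.induction_on with
  | empty => simpa using const 0
  | insert i s hi ih =>
    have h1 := H i (Finset.mem_insert_self _ _)
    have h2 := ih fun j hj => H j (Finset.mem_insert_of_mem hj)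
    simpa [Finset.sum_insert hi] using h1.add h2

theorem log (H : HasJet φ z g l) (h0 : φ z ≠ 0) :
    HasJet (fun w => Real.log (φ w)) z ((φ z)⁻¹ * g) (l / φ z - ‖g‖ ^ 2 / φ z ^ 2) := by
  have := H.comp (χ := Real.log) (Real.contDiffAt_log.2 h0)
  refine this.congr_val (by simp) ?_
  have hd : deriv Real.log = fun x => x⁻¹ := by ext x; simp
  rw [hd]; simp; ring

theorem exp (H : HasJet φ z g l) :
    HasJet (fun w => Real.exp (φ w)) z (Real.exp (φ z) * g)
      (Real.exp (φ z) * (l + ‖g‖ ^ 2)) := by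
  have := H.comp (χ := Real.exp) Real.contDiff_exp.contDiffAt
  refine this.congr_val (by simp) ?_
  simp; ring

/-- The squared modulus of a holomorphic function. -/
theorem norm_sq {f : ℂ → ℂ} (hf : AnalyticAt ℂ f z) :
    HasJet (fun w => ‖f w‖ ^ 2) z (2 * f z * (starRingEnd ℂ) (deriv f z))
      (4 * ‖deriv f z‖ ^ 2) := by
  have hre : ∀ {F : ℂ → ℂ} {F' w : ℂ}, HasDerivAt F F' w → ∀ v,
      dirDeriv v (fun w => (F w).re) w = (v * F').re := fun {F F' w} h v => by
    have := Complex.reCLM.hasFDerivAt.comp w (h.hasFDerivAt.restrictScalars ℝ)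
    rw [dirDeriv, show (fun w => (F w).re) = Complex.reCLM ∘ F from rfl, this.fderiv]
    simp
  have hdre : ∀ {F : ℂ → ℂ} {F' w : ℂ}, HasDerivAt F F' w →
      HasFDerivAt (fun w => (F w).re) (fderiv ℝ (fun w => (F w).re) w) w := fun {F F' w} h => by
    have := Complex.reCLM.hasFDerivAt.comp w (h.hasFDerivAt.restrictScalars ℝ)
    exact this.differentiableAt.hasFDerivAt
  have him : ∀ {F : ℂ → ℂ} {F' w : ℂ}, HasDerivAt F F' w → ∀ v,
      dirDeriv v (fun w => (F w).im) w = (v * F').im := fun {F F' w} h v => by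
    have := Complex.imCLM.hasFDerivAt.comp w (h.hasFDerivAt.restrictScalars ℝ)
    rw [dirDeriv, show (fun w => (F w).im) = Complex.imCLM ∘ F from rfl, this.fderiv]
    simp
  have hdim : ∀ {F : ℂ → ℂ} {F' w : ℂ}, HasDerivAt F F' w →
      HasFDerivAt (fun w => (F w).im) (fderiv ℝ (fun w => (F w).im) w) w := fun {F F' w} h => by
    have := Complex.imCLM.hasFDerivAt.comp w (h.hasFDerivAt.restrictScalars ℝ)
    exact this.differentiableAt.hasFDerivAt
  have hsq : (fun w => ‖f w‖ ^ 2) = fun w => (f w).re * (f w).re + (f w).im * (f w).im := by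
    ext w; rw [← Complex.normSq_eq_norm_sq, Complex.normSq_apply]
  have e : ∀ v, dirDeriv v (fun w => ‖f w‖ ^ 2) =ᶠ[nhds z]
      fun w => 2 * ((f w).re * (v * deriv f w).re + (f w).im * (v * deriv f w).im) := fun v => by
    filter_upwards [hf.eventually_analyticAt] with w hw
    have h := hw.differentiableAt.hasDerivAt
    have h1 := hre h v
    have h2 := him h v
    have h3 := ((hdre h).fun_mul (hdre h)).fun_add ((hdim h).fun_mul (hdim h))
    rw [hsq, dirDeriv, h3.fderiv]
    simp only [dirDeriv] at h1 h2
    simp only [add_apply, smul_apply, h1, h2, smul_eq_mul]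
    ring
  have h := hf.differentiableAt.hasDerivAt
  have h' := hf.deriv.differentiableAt.hasDerivAt
  have e2 : ∀ v, dirDeriv v (dirDeriv v (fun w => ‖f w‖ ^ 2)) z =
      2 * (‖v * deriv f z‖ ^ 2 + ((f z).re * (v * (v * deriv (deriv f) z)).re
        + (f z).im * (v * (v * deriv (deriv f) z)).im)) := fun v => by
    have k := h'.const_mul v
    have h3 := (((hdre h).fun_mul (hdre k)).fun_add
      ((hdim h).fun_mul (hdim k))).const_mul 2
    rw [(dirDeriv_congr (e v) v).eq_of_nhds, dirDeriv, h3.fderiv]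
    have h1 := hre h v
    have h2 := him h v
    have h1' := hre k v
    have h2' := him k v
    simp only [dirDeriv] at h1 h2 h1' h2'
    simp only [add_apply, smul_apply, h1, h2, h1', h2',
      smul_eq_mul]
    rw [← Complex.normSq_eq_norm_sq, Complex.normSq_apply]
    ring
  refine ⟨?_, ?_, ?_, ?_⟩
  · have : ContDiffAt ℝ 2 f z := (hf.contDiffAt (n := 2)).restrict_scalars ℝ
    rw [hsq]
    have h1 : ContDiffAt ℝ 2 (fun w => (f w).re) z := Complex.reCLM.contDiff.contDiffAt.comp z this
    have h2 : ContDiffAt ℝ 2 (fun w => (f w).im) z := Complex.imCLM.contDiff.contDiffAt.comp z this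
    exact (h1.mul h1).add (h2.mul h2)
  · rw [(e 1).eq_of_nhds]; simp; ring
  · rw [(e Complex.I).eq_of_nhds]; simp; ring
  · rw [planeLaplacian, e2, e2]
    simp; ring

end HasJet

/-- `Δ ½ log (|f|² + δ²)` for holomorphic `f`. -/
theorem hasJet_log_norm_sq_add {f : ℂ → ℂ} {z : ℂ} (hf : AnalyticAt ℂ f z) {d : ℝ} (hd : 0 < d) :
    HasJet (fun w => 1 / 2 * Real.log (‖f w‖ ^ 2 + d ^ 2)) z
      ((f z * (starRingEnd ℂ) (deriv f z)) / ((‖f z‖ ^ 2 + d ^ 2 : ℝ) : ℂ))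
      (2 * ‖deriv f z‖ ^ 2 * d ^ 2 / (‖f z‖ ^ 2 + d ^ 2) ^ 2) := by
  have hp : 0 < ‖f z‖ ^ 2 + d ^ 2 := by positivity
  have := (((HasJet.norm_sq hf).add (HasJet.const (d ^ 2))).log hp.ne').const_mul (1 / 2)
  refine this.congr_val ?_ ?_
  · have : ((‖f z‖ ^ 2 + d ^ 2 : ℝ) : ℂ) ≠ 0 := by exact_mod_cast hp.ne'
    push_cast at this ⊢
    field_simp
    ring
  · simp only [add_zero, norm_mul, RCLike.norm_conj, Complex.norm_ofNat]
    field_simp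
    ring

theorem hasJet_one_sub_norm_sq (z : ℂ) : HasJet (fun w => 1 - ‖w‖ ^ 2) z (-2 * z) (-4) := by
  have h := HasJet.norm_sq (f := fun w => w) (z := z) (by fun_prop)
  have := (h.const_mul (-1)).add (HasJet.const 1)
  refine (this.congr (.of_eq ?_)).congr_val ?_ ?_
  · ext w; ring
  · simp
  · simp

theorem hasJet_log_norm_sub {z b : ℂ} (h : z ≠ b) :
    HasJet (fun w => Real.log ‖w - b‖) z ((z - b) / ((‖z - b‖ ^ 2 : ℝ) : ℂ)) 0 := by
  have h0 : ‖z - b‖ ≠ 0 := by simpa [sub_eq_zero] using h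
  have hd : deriv (fun w : ℂ => w - b) z = 1 := by simp
  have := (((HasJet.norm_sq (f := fun w => w - b) (z := z) (by fun_prop)).log
    (by positivity)).const_mul (1 / 2))
  refine (this.congr (.of_eq ?_)).congr_val ?_ ?_
  · ext w; rw [Real.log_pow]; push_cast; ring
  · rw [hd]; push_cast; simp; ring
  · rw [hd]
    simp only [norm_mul, RCLike.norm_conj, Complex.norm_ofNat, norm_one]
    field_simp
    ring

theorem hasJet_norm_sub {z b : ℂ} (h : z ≠ b) :
    HasJet (fun w => ‖w - b‖) z ((z - b) / (‖z - b‖ : ℂ)) (1 / ‖z - b‖) := by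
  have h0 : 0 < ‖z - b‖ := by simpa [sub_eq_zero] using h
  have h0' : (‖z - b‖ : ℂ) ≠ 0 := by exact_mod_cast h0.ne'
  have := (hasJet_log_norm_sub h).exp
  rw [Real.exp_log h0] at this
  refine (this.congr ?_).congr_val ?_ ?_
  · filter_upwards [isOpen_ne.mem_nhds h] with w hw
    rw [Real.exp_log]
    simpa [sub_eq_zero] using hw
  · push_cast; field_simp
  · rw [norm_div, Complex.norm_real, Real.norm_of_nonneg (by positivity)]
    field_simp
    simp

/-! ### Blow-up of the Riesz mass at a zero -/

open MeasureTheory in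
/-- A radial function integrates in polar coordinates to a one-dimensional integral. -/
theorem lintegral_comp_norm_complex (F : ℝ → ℝ≥0∞) (hF : Measurable F) :
    ∫⁻ z : ℂ, F ‖z‖ = ENNReal.ofReal (2 * Real.pi) *
      ∫⁻ r in Set.Ioi (0 : ℝ), ENNReal.ofReal r * F r := by
  rw [← Complex.lintegral_comp_polarCoord_symm, polarCoord_target, Measure.volume_eq_prod,
    ← Measure.prod_restrict]
  have h1 : ∀ᵐ p : ℝ × ℝ ∂((volume.restrict (Set.Ioi (0 : ℝ))).prod
      (volume.restrict (Set.Ioo (-Real.pi) Real.pi))),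
      ENNReal.ofReal p.1 • F ‖Complex.polarCoord.symm p‖
        = (ENNReal.ofReal p.1 * F p.1) * 1 := by
    rw [Measure.prod_restrict]
    filter_upwards [ae_restrict_mem (measurableSet_Ioi.prod measurableSet_Ioo)] with p hp
    rw [Complex.norm_polarCoord_symm, abs_of_pos hp.1, mul_one, smul_eq_mul]
  rw [lintegral_congr_ae h1,
    lintegral_prod_mul (f := fun r => ENNReal.ofReal r * F r) (g := fun _ => 1)
      (by fun_prop) (by fun_prop)]
  simp only [lintegral_const, Measure.restrict_apply MeasurableSet.univ, Set.univ_inter,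
    Real.volume_Ioo, one_mul]
  rw [mul_comm]; congr 2; ring

open MeasureTheory Filter Topology in
/-- The total mass of `Δ ½ log (|bzᵐ⁺¹|² + 1)` is `2π (m + 1)`. -/
theorem lintegral_power_density (m : ℕ) {b : ℝ} (hb : 0 < b) :
    ∫⁻ z : ℂ, ENNReal.ofReal (2 * (m + 1) ^ 2 * b ^ 2 * ‖z‖ ^ (2 * m) /
      (b ^ 2 * ‖z‖ ^ (2 * (m + 1)) + 1) ^ 2) = ENNReal.ofReal (2 * Real.pi * (m + 1)) := by
  rw [lintegral_comp_norm_complex (fun r => ENNReal.ofReal (2 * (m + 1) ^ 2 * b ^ 2 * r ^ (2 * m) /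
      (b ^ 2 * r ^ (2 * (m + 1)) + 1) ^ 2)) (by fun_prop),
    ENNReal.ofReal_mul (p := 2 * Real.pi) (by positivity)]
  congr 1
  set G : ℝ → ℝ := fun r => -((m + 1) / (b ^ 2 * r ^ (2 * (m + 1)) + 1)) with hG
  set G' : ℝ → ℝ := fun r => r * (2 * (m + 1) ^ 2 * b ^ 2 * r ^ (2 * m) /
      (b ^ 2 * r ^ (2 * (m + 1)) + 1) ^ 2) with hG'
  have hpos : ∀ r : ℝ, 0 < b ^ 2 * r ^ (2 * (m + 1)) + 1 := fun r => by
    have : 0 ≤ r ^ (2 * (m + 1)) := by rw [pow_mul]; positivity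
    positivity
  have hd : ∀ r ∈ Set.Ici (0 : ℝ), HasDerivAt G (G' r) r := fun r _ => by
    have h := (((hasDerivAt_pow (2 * (m + 1)) r).const_mul (b ^ 2)).add_const 1)
    have h2 := ((hasDerivAt_const r ((m : ℝ) + 1)).div h (hpos r).ne').neg
    refine h2.congr_deriv ?_
    have e : 2 * (m + 1) - 1 = 2 * m + 1 := by omega
    rw [hG', e]
    push_cast
    field_simp
    ring
  have hpos' : ∀ r ∈ Set.Ioi (0 : ℝ), 0 ≤ G' r := fun r hr => by
    have : (0 : ℝ) < r := hr
    simp only [hG']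
    positivity
  have hlim : Tendsto G atTop (𝓝 0) := by
    have h1 : Tendsto (fun r : ℝ => b ^ 2 * r ^ (2 * (m + 1)) + 1) atTop atTop :=
      tendsto_atTop_add_const_right _ _
        ((tendsto_pow_atTop (by omega)).const_mul_atTop (by positivity))
    have := (h1.const_div_atTop ((m : ℝ) + 1)).neg
    simpa using this
  have hint := integral_Ioi_of_hasDerivAt_of_nonneg' hd hpos' hlim
  have hig := integrableOn_Ioi_deriv_of_nonneg' hd hpos' hlim
  have : G 0 = -((m : ℝ) + 1) := by simp [hG]
  rw [this, sub_neg_eq_add, zero_add] at hint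
  have hmass := ofReal_integral_eq_lintegral_ofReal hig
    ((ae_restrict_mem measurableSet_Ioi).mono hpos')
  rw [hint] at hmass
  rw [hmass]
  refine setLIntegral_congr_fun measurableSet_Ioi fun r hr => ?_
  rw [hG', ← ENNReal.ofReal_mul (le_of_lt hr)]

open MeasureTheory in
theorem lintegral_comp_add_smul_complex (H : ℂ → ℝ≥0∞) (hH : Measurable H) (c : ℂ) {s : ℝ}
    (hs : 0 < s) : ∫⁻ w : ℂ, ENNReal.ofReal (s ^ 2) * H (c + s • w) = ∫⁻ z, H z := by
  rw [lintegral_const_mul _ (by fun_prop)]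
  have h1 : ∫⁻ w : ℂ, H (c + s • w) = ∫⁻ z, H (c + z) ∂(Measure.map (s • ·) volume) := by
    rw [lintegral_map (by fun_prop) (by fun_prop)]
  rw [h1, Measure.map_addHaar_smul volume hs.ne', lintegral_smul_measure,
    lintegral_add_left_eq_self, smul_eq_mul, ← mul_assoc, ← ENNReal.ofReal_mul (by positivity),
    Complex.finrank_real_complex, abs_of_nonneg (by positivity), mul_inv_cancel₀ (by positivity),
    ENNReal.ofReal_one, one_mul]

/-- The Laplacian of `½ log (|f|² + d²)`, as a density of mass. For `d → 0` it concentrates on the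
zeros of `f`, with mass `2π` times the multiplicity. -/
noncomputable def zeroDensity (f : ℂ → ℂ) (d : ℝ) (z : ℂ) : ℝ :=
  2 * ‖deriv f z‖ ^ 2 * d ^ 2 / (‖f z‖ ^ 2 + d ^ 2) ^ 2

theorem zeroDensity_nonneg (f : ℂ → ℂ) (d : ℝ) (z : ℂ) : 0 ≤ zeroDensity f d z := by
  unfold zeroDensity; positivity

open MeasureTheory Filter Topology in
/-- Blow-up at a zero `c` of order `m + 1`: with `d = s ^ (m + 1)`, the substitution `z = c + s w`
turns the mass density near `c` into one that converges pointwise. -/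
theorem tendsto_zeroDensity_rescaled {f : ℂ → ℂ} {c : ℂ} {m : ℕ} (hf : AnalyticAt ℂ f c)
    (hm : analyticOrderAt f c = (m + 1 : ℕ)) :
    ∃ b : ℝ, 0 < b ∧ ∀ {φ : ℂ → ℝ}, ContinuousAt φ c → ∀ {s : ℕ → ℝ}, (∀ k, 0 < s k) →
      Tendsto s atTop (𝓝 0) → ∀ w : ℂ,
      Tendsto (fun k => s k ^ 2 * (φ (c + s k • w) *
        zeroDensity f (s k ^ (m + 1)) (c + s k • w))) atTop
        (𝓝 (φ c * (2 * (m + 1) ^ 2 * b ^ 2 * ‖w‖ ^ (2 * m) /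
          (b ^ 2 * ‖w‖ ^ (2 * (m + 1)) + 1) ^ 2))) := by
  obtain ⟨g, hg, hg0, hfg⟩ := hf.analyticOrderAt_eq_natCast.1 hm
  refine ⟨‖g c‖, by simpa using hg0, fun {φ} hφ s hs hs0 w => ?_⟩
  have hz : Tendsto (fun k => c + s k • w) atTop (𝓝 c) := by
    have : Tendsto (fun k => s k • w) atTop (𝓝 ((0 : ℝ) • w)) := hs0.smul_const w
    simpa using this.const_add c
  have hd : ∀ᶠ z in 𝓝 c, deriv f z = (z - c) ^ m * ((m + 1) * g z + (z - c) * deriv g z) := by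
    filter_upwards [hfg.eventually_nhds, hg.eventually_analyticAt] with z h1 h2
    rw [EventuallyEq.deriv_eq (f := fun z => (z - c) ^ (m + 1) * g z)
      (by filter_upwards [h1] with y hy using by simpa using hy)]
    have h3 := (((hasDerivAt_id z).sub_const c).pow (m + 1)).mul h2.differentiableAt.hasDerivAt
    rw [show (fun z => (z - c) ^ (m + 1) * g z) = ((fun x => id x - c) ^ (m + 1) * g) from rfl,
      h3.deriv]
    simp
    ring
  have hlim : Tendsto (fun k => φ (c + s k • w) * (2 * ‖w‖ ^ (2 * m) *
      ‖(m + 1) * g (c + s k • w) + (s k • w) * deriv g (c + s k • w)‖ ^ 2 /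
      (‖g (c + s k • w)‖ ^ 2 * ‖w‖ ^ (2 * (m + 1)) + 1) ^ 2)) atTop
      (𝓝 (φ c * (2 * ‖w‖ ^ (2 * m) * ‖(m + 1) * g c + 0 * deriv g c‖ ^ 2 /
        (‖g c‖ ^ 2 * ‖w‖ ^ (2 * (m + 1)) + 1) ^ 2))) := by
    have h1 : Tendsto (fun k => φ (c + s k • w)) atTop (𝓝 (φ c)) := hφ.tendsto.comp hz
    have h2 : Tendsto (fun k => g (c + s k • w)) atTop (𝓝 (g c)) :=
      hg.continuousAt.tendsto.comp hz
    have h3 : Tendsto (fun k => deriv g (c + s k • w)) atTop (𝓝 (deriv g c)) :=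
      hg.deriv.continuousAt.tendsto.comp hz
    have h4 : Tendsto (fun k => s k • w) atTop (𝓝 0) := by
      simpa using hs0.smul_const w
    refine h1.mul (Tendsto.div ?_ ?_ (by positivity))
    · exact (((h2.const_mul _).add (h4.mul h3)).norm.pow 2).const_mul _
    · exact (((h2.norm.pow 2).mul_const _).add_const 1).pow 2
  have hval : φ c * (2 * ‖w‖ ^ (2 * m) * ‖(m + 1) * g c + 0 * deriv g c‖ ^ 2 /
        (‖g c‖ ^ 2 * ‖w‖ ^ (2 * (m + 1)) + 1) ^ 2) = φ c * (2 * (m + 1) ^ 2 * ‖g c‖ ^ 2 *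
          ‖w‖ ^ (2 * m) / (‖g c‖ ^ 2 * ‖w‖ ^ (2 * (m + 1)) + 1) ^ 2) := by
    have : ‖((m : ℂ) + 1)‖ = m + 1 := by
      have := Complex.norm_natCast (m + 1)
      push_cast at this
      exact this
    rw [zero_mul, add_zero, norm_mul, this]; ring
  rw [← hval]
  refine hlim.congr' ?_
  filter_upwards [hz.eventually hd, hz.eventually hfg] with k h1 h2
  have hsk := hs k
  simp only [zeroDensity, h1, h2, add_sub_cancel_left, smul_eq_mul, norm_mul, norm_pow, norm_smul,
    Real.norm_of_nonneg hsk.le]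
  have hp : 0 < ‖g (c + s k • w)‖ ^ 2 * ‖w‖ ^ (2 * (m + 1)) + 1 := by positivity
  have e : ((s k * ‖w‖) ^ (m + 1) * ‖g (c + s k • w)‖) ^ 2 + (s k ^ (m + 1)) ^ 2 =
      (s k ^ (m + 1)) ^ 2 * (‖g (c + s k • w)‖ ^ 2 * ‖w‖ ^ (2 * (m + 1)) + 1) := by ring
  rw [e]
  field_simp
  ring

/-! ### Green's identity and the Riesz inequality -/

section
open MeasureTheory Filter Topology

theorem continuous_mul_of_continuousAt_tsupport {u φ : ℂ → ℝ} (hφ : Continuous φ)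
    (hu : ∀ z ∈ tsupport φ, ContinuousAt u z) : Continuous fun z => u z * φ z := by
  rw [continuous_iff_continuousAt]
  intro z
  by_cases hz : z ∈ tsupport φ
  · exact (hu z hz).mul hφ.continuousAt
  · have : (fun z => u z * φ z) =ᶠ[𝓝 z] fun _ => 0 := by
      filter_upwards [notMem_tsupport_iff_eventuallyEq.1 hz] with w hw
      simp [hw]
    exact continuousAt_const.congr this.symm

theorem integrable_mul_of_continuousAt_tsupport {u φ : ℂ → ℝ} (hφ : Continuous φ)
    (hs : HasCompactSupport φ) (hu : ∀ z ∈ tsupport φ, ContinuousAt u z) :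
    Integrable fun z => u z * φ z :=
  (continuous_mul_of_continuousAt_tsupport hφ hu).integrable_of_hasCompactSupport hs.mul_left

theorem tsupport_dirDeriv_subset (φ : ℂ → ℝ) (v : ℂ) : tsupport (dirDeriv v φ) ⊆ tsupport φ := by
  refine closure_minimal (fun z hz => ?_) (isClosed_tsupport φ)
  by_contra h
  have := (dirDeriv_congr (notMem_tsupport_iff_eventuallyEq.1 h) v).eq_of_nhds
  exact hz (this.trans (by simp [dirDeriv]))

theorem HasCompactSupport.dirDeriv {φ : ℂ → ℝ} (h : HasCompactSupport φ) (v : ℂ) :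
    HasCompactSupport (dirDeriv v φ) :=
  h.of_isClosed_subset (isClosed_tsupport _) (tsupport_dirDeriv_subset φ v)

/-- Integrating by parts twice: `∫ u ∂ᵥ∂ᵥφ = ∫ (∂ᵥ∂ᵥu) φ` for a test function `φ`, where `u` need
only be smooth on the support of `φ`. -/
theorem integral_mul_dirDeriv_dirDeriv {u φ : ℂ → ℝ} (hφ : ContDiff ℝ 2 φ)
    (hs : HasCompactSupport φ) (hu : ∀ z ∈ tsupport φ, ContDiffAt ℝ 2 u z) (v : ℂ) :
    ∫ z, u z * dirDeriv v (dirDeriv v φ) z = ∫ z, dirDeriv v (dirDeriv v u) z * φ z := by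
  have hd1 : ContDiff ℝ 1 (dirDeriv v φ) :=
    contDiff_iff_contDiffAt.2 fun z => hφ.contDiffAt.dirDeriv v
  have hd2 : Continuous (dirDeriv v (dirDeriv v φ)) := by
    have := hd1.continuous_fderiv (by norm_num)
    exact this.clm_apply continuous_const
  have hs1 := hs.dirDeriv v
  have hs2 := hs1.dirDeriv v
  have t1 := tsupport_dirDeriv_subset φ v
  have t2 := (tsupport_dirDeriv_subset (dirDeriv v φ) v).trans t1
  have c0 : ∀ z ∈ tsupport φ, ContinuousAt u z := fun z hz => (hu z hz).continuousAt
  have c1 : ∀ z ∈ tsupport φ, ContinuousAt (dirDeriv v u) z := fun z hz =>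
    ((hu z hz).dirDeriv v).continuousAt
  have c2 : ∀ z ∈ tsupport φ, ContinuousAt (dirDeriv v (dirDeriv v u)) z := fun z hz => by
    have := ((hu z hz).dirDeriv v).fderiv_right (m := 0) (by norm_num)
    exact (this.clm_apply contDiffAt_const).continuousAt
  have step1 := integral_mul_fderiv_eq_neg_fderiv_mul_of_integrable (μ := volume) (f := u)
    (g := dirDeriv v φ) (v := v)
    (integrable_mul_of_continuousAt_tsupport hd1.continuous hs1 fun z hz => c1 z (t1 hz))
    (integrable_mul_of_continuousAt_tsupport hd2 hs2 fun z hz => c0 z (t2 hz))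
    (integrable_mul_of_continuousAt_tsupport hd1.continuous hs1 fun z hz => c0 z (t1 hz))
    (fun z hz => (hu z (t1 hz)).differentiableAt (by norm_num))
    (fun z _ => hd1.differentiable (by norm_num) z)
  have step2 := integral_mul_fderiv_eq_neg_fderiv_mul_of_integrable (μ := volume)
    (f := dirDeriv v u) (g := φ) (v := v)
    (integrable_mul_of_continuousAt_tsupport hφ.continuous hs c2)
    (integrable_mul_of_continuousAt_tsupport hd1.continuous hs1 fun z hz => c1 z (t1 hz))
    (integrable_mul_of_continuousAt_tsupport hφ.continuous hs c1)
    (fun z hz => ((hu z hz).dirDeriv v).differentiableAt (by norm_num))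
    (fun z _ => hφ.differentiable (by norm_num) z)
  have e : ∀ (ψ : ℂ → ℝ) (z : ℂ), fderiv ℝ ψ z v = dirDeriv v ψ z := fun _ _ => rfl
  simp only [e] at step1 step2
  rw [step1, step2, neg_neg]

theorem ContDiff.continuous_planeLaplacian {φ : ℂ → ℝ} (hφ : ContDiff ℝ 2 φ) :
    Continuous (planeLaplacian φ) :=
  continuous_iff_continuousAt.2 fun _ => hφ.contDiffAt.planeLaplacian

theorem tsupport_planeLaplacian_subset (φ : ℂ → ℝ) :
    tsupport (planeLaplacian φ) ⊆ tsupport φ := by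
  refine closure_minimal (fun z hz => ?_) (isClosed_tsupport φ)
  by_contra h
  refine hz ((planeLaplacian_congr (notMem_tsupport_iff_eventuallyEq.1 h)).trans ?_)
  exact (HasJet.const (z := z) 0).lap

theorem HasCompactSupport.planeLaplacian {φ : ℂ → ℝ} (h : HasCompactSupport φ) :
    HasCompactSupport (planeLaplacian φ) :=
  h.of_isClosed_subset (isClosed_tsupport _) (tsupport_planeLaplacian_subset φ)

/-- Green's identity `∫ u Δφ = ∫ (Δu) φ` for a test function `φ`. -/
theorem integral_mul_planeLaplacian {u φ : ℂ → ℝ} (hφ : ContDiff ℝ 2 φ)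
    (hs : HasCompactSupport φ) (hu : ∀ z ∈ tsupport φ, ContDiffAt ℝ 2 u z) :
    ∫ z, u z * planeLaplacian φ z = ∫ z, planeLaplacian u z * φ z := by
  have i1 : ∀ v, Integrable fun z => u z * dirDeriv v (dirDeriv v φ) z := fun v => by
    have hd1 : ContDiff ℝ 1 (dirDeriv v φ) :=
      contDiff_iff_contDiffAt.2 fun z => hφ.contDiffAt.dirDeriv v
    have hd2 : Continuous (dirDeriv v (dirDeriv v φ)) :=
      (hd1.continuous_fderiv (by norm_num)).clm_apply continuous_const
    exact integrable_mul_of_continuousAt_tsupport hd2 ((hs.dirDeriv v).dirDeriv v) fun z hz =>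
      (hu z (tsupport_dirDeriv_subset _ _ (tsupport_dirDeriv_subset _ _ hz))).continuousAt
  have i2 : ∀ v, Integrable fun z => dirDeriv v (dirDeriv v u) z * φ z := fun v =>
    integrable_mul_of_continuousAt_tsupport hφ.continuous hs fun z hz => by
      have := ((hu z hz).dirDeriv v).fderiv_right (m := 0) (by norm_num)
      exact (this.clm_apply contDiffAt_const).continuousAt
  simp only [planeLaplacian, mul_add, add_mul]
  rw [integral_add (i1 _) (i1 _), integral_add (i2 _) (i2 _),
    integral_mul_dirDeriv_dirDeriv hφ hs hu, integral_mul_dirDeriv_dirDeriv hφ hs hu]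

/-- The smooth subharmonic majorant `½ log (|f|² + d²)` of `log |f|`. -/
noncomputable def smoothLog (f : ℂ → ℂ) (d : ℝ) (z : ℂ) : ℝ :=
  1 / 2 * Real.log (‖f z‖ ^ 2 + d ^ 2)

/-- Green's identity for `½ log (|f|² + d²)`. -/
theorem integral_smoothLog_mul_planeLaplacian {f : ℂ → ℂ} {φ : ℂ → ℝ} (hφ : ContDiff ℝ 2 φ)
    (hs : HasCompactSupport φ) (hf : ∀ z ∈ tsupport φ, AnalyticAt ℂ f z) {d : ℝ} (hd : 0 < d) :
    ∫ z, smoothLog f d z * planeLaplacian φ z = ∫ z, zeroDensity f d z * φ z := by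
  rw [integral_mul_planeLaplacian (u := smoothLog f d) hφ hs fun z hz =>
    (hasJet_log_norm_sq_add (hf z hz) hd).contDiffAt]
  refine integral_congr_ae (.of_forall fun z => ?_)
  by_cases hz : z ∈ tsupport φ
  · beta_reduce
    rw [show planeLaplacian (smoothLog f d) z = zeroDensity f d z from
      (hasJet_log_norm_sq_add (hf z hz) hd).lap]
  · simp [image_eq_zero_of_notMem_tsupport hz]

theorem continuousAt_zeroDensity {f : ℂ → ℂ} {z : ℂ} (hf : AnalyticAt ℂ f z) {d : ℝ} (hd : 0 < d) :
    ContinuousAt (zeroDensity f d) z := by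
  have h1 := hf.continuousAt
  have h2 := hf.deriv.continuousAt
  unfold zeroDensity
  exact (((h2.norm.pow 2).const_mul 2).mul_const _).div (((h1.norm.pow 2).add_const _).pow 2)
    (by positivity)

/-- **Riesz inequality.** If `∫ ½ log (|f|² + d²) Δφ ≤ A + A' d²` for all `d > 0`, then the sum of a
nonnegative test function `φ` over zeros of `f`, with multiplicity, is at most `A / 2π`. -/
theorem sum_zeros_le_of_integral_smoothLog_le {f : ℂ → ℂ} {φ : ℂ → ℝ} (hφ : ContDiff ℝ 2 φ)
    (hs : HasCompactSupport φ) (hφ0 : ∀ z, 0 ≤ φ z) (hf : ∀ z ∈ tsupport φ, AnalyticAt ℂ f z)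
    (S : Finset ℂ) (m : ℂ → ℕ)
    (hS : ∀ z ∈ S, AnalyticAt ℂ f z ∧ analyticOrderAt f z = (m z + 1 : ℕ)) {A A' : ℝ}
    (hA : ∀ d, 0 < d → ∫ z, smoothLog f d z * planeLaplacian φ z ≤ A + A' * d ^ 2) :
    ∑ z ∈ S, 2 * Real.pi * (m z + 1) * φ z ≤ A := by
  classical
  -- pairwise disjoint discs around the points of `S`
  obtain ⟨ρ, hρ, hdisj⟩ : ∃ ρ > 0, (S : Set ℂ).PairwiseDisjoint fun z => Metric.ball z ρ := by
    obtain ⟨ρ, hρ, h⟩ : ∃ ρ > 0, ∀ x ∈ S, ∀ y ∈ S, x ≠ y → 2 * ρ ≤ dist x y := by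
      rcases (S.offDiag).eq_empty_or_nonempty with h | h
      · refine ⟨1, one_pos, fun x hx y hy hxy => ?_⟩
        have : (x, y) ∈ S.offDiag := Finset.mem_offDiag.2 ⟨hx, hy, hxy⟩
        simp [h] at this
      · obtain ⟨p, hp, hmin⟩ := S.offDiag.exists_min_image (fun p => dist p.1 p.2) h
        refine ⟨dist p.1 p.2 / 2, half_pos (dist_pos.2 (Finset.mem_offDiag.1 hp).2.2),
          fun x hx y hy hxy => ?_⟩
        have := hmin (x, y) (Finset.mem_offDiag.2 ⟨hx, hy, hxy⟩)
        simp only at this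
        linarith
    refine ⟨ρ, hρ, fun x hx y hy hxy => Metric.ball_disjoint_ball ?_⟩
    have := h x hx y hy hxy
    linarith
  -- a common parameter `d k = 1 / (k + 1)`, with a root of it for each zero
  set d : ℕ → ℝ := fun k => 1 / ((k : ℝ) + 1) with hd
  have hdpos : ∀ k, 0 < d k := fun k => by positivity
  have hd0 : Tendsto d atTop (𝓝 0) := tendsto_one_div_add_atTop_nhds_zero_nat
  set s : ℂ → ℕ → ℝ := fun z k => d k ^ (1 / ((m z : ℝ) + 1)) with hsdef
  have hspos : ∀ z k, 0 < s z k := fun z k => Real.rpow_pos_of_pos (hdpos k) _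
  have hspow : ∀ z k, s z k ^ (m z + 1) = d k := fun z k => by
    rw [hsdef, ← Real.rpow_natCast, ← Real.rpow_mul (hdpos k).le]
    push_cast
    rw [one_div_mul_cancel (by positivity), Real.rpow_one]
  have hs0 : ∀ z, Tendsto (s z) atTop (𝓝 0) := fun z => by
    have h : (0 : ℝ) < 1 / ((m z : ℝ) + 1) := by positivity
    have := hd0.rpow_const (Or.inr h.le)
    rwa [Real.zero_rpow h.ne'] at this
  -- the mass densities, which are continuous
  set H : ℕ → ℂ → ℝ≥0∞ := fun k z => ENNReal.ofReal (zeroDensity f (d k) z * φ z) with hH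
  have hcont : ∀ k, Continuous fun z => zeroDensity f (d k) z * φ z := fun k =>
    continuous_mul_of_continuousAt_tsupport hφ.continuous fun z hz =>
      continuousAt_zeroDensity (hf z hz) (hdpos k)
  have hHm : ∀ k, Measurable (H k) := fun k => (hcont k).measurable.ennreal_ofReal
  have hHint : ∀ k, ∫⁻ z, H k z ≤ ENNReal.ofReal (A + A' * d k ^ 2) := fun k => by
    rw [hH, ← ofReal_integral_eq_lintegral_ofReal
      (integrable_mul_of_continuousAt_tsupport hφ.continuous hs fun z hz =>
        continuousAt_zeroDensity (hf z hz) (hdpos k))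
      (.of_forall fun z => mul_nonneg (zeroDensity_nonneg _ _ _) (hφ0 z)),
      ← integral_smoothLog_mul_planeLaplacian hφ hs hf (hdpos k)]
    exact ENNReal.ofReal_le_ofReal (hA _ (hdpos k))
  -- the rescaled densities near each zero
  set G : ℂ → ℕ → ℂ → ℝ≥0∞ := fun z k w => ENNReal.ofReal (s z k ^ 2) *
    (Metric.ball z ρ).indicator (H k) (z + s z k • w) with hG
  have hGm : ∀ z k, Measurable (G z k) := fun z k => by
    have : Measurable ((Metric.ball z ρ).indicator (H k)) :=
      (hHm k).indicator measurableSet_ball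
    exact (this.comp (by fun_prop)).const_mul _
  have hGint : ∀ z k, ∫⁻ w, G z k w = ∫⁻ x in Metric.ball z ρ, H k x := fun z k => by
    rw [hG, lintegral_comp_add_smul_complex _ ((hHm k).indicator measurableSet_ball) z (hspos z k),
      lintegral_indicator measurableSet_ball]
  have hlim : ∀ z ∈ S, ∃ b : ℝ, 0 < b ∧ ∀ w, Tendsto (fun k => G z k w) atTop
      (𝓝 (ENNReal.ofReal (φ z * (2 * (m z + 1) ^ 2 * b ^ 2 * ‖w‖ ^ (2 * m z) /
        (b ^ 2 * ‖w‖ ^ (2 * (m z + 1)) + 1) ^ 2)))) := fun z hz => by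
    obtain ⟨b, hb, h⟩ := tendsto_zeroDensity_rescaled (hS z hz).1 (hS z hz).2
    refine ⟨b, hb, fun w => ?_⟩
    have h1 := ENNReal.tendsto_ofReal
      (h (hφ.continuous.continuousAt (x := z)) (hspos z) (hs0 z) w)
    refine h1.congr' ?_
    have hz' : Tendsto (fun k => z + s z k • w) atTop (𝓝 z) := by
      have : Tendsto (fun k => s z k • w) atTop (𝓝 ((0 : ℝ) • w)) := (hs0 z).smul_const w
      simpa using this.const_add z
    filter_upwards [hz'.eventually (Metric.ball_mem_nhds z hρ)] with k hk
    rw [hG]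
    simp only
    rw [Set.indicator_of_mem (Metric.mem_ball.2 hk), hH, ← ENNReal.ofReal_mul (by positivity), hspow]
    congr 1; ring
  choose! b hb hlim using hlim
  have hfatou := lintegral_liminf_le (μ := volume) (u := atTop)
    (f := fun k w => ∑ z ∈ S, G z k w)
    (fun k => Finset.measurable_fun_sum S fun z _ => hGm z k)
  have hL : ∫⁻ w, liminf (fun k => ∑ z ∈ S, G z k w) atTop =
      ENNReal.ofReal (∑ z ∈ S, 2 * Real.pi * (m z + 1) * φ z) := by
    have : ∀ w, liminf (fun k => ∑ z ∈ S, G z k w) atTop =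
        ∑ z ∈ S, ENNReal.ofReal (φ z) * ENNReal.ofReal (2 * (m z + 1) ^ 2 * b z ^ 2 *
          ‖w‖ ^ (2 * m z) / (b z ^ 2 * ‖w‖ ^ (2 * (m z + 1)) + 1) ^ 2) := fun w => by
      rw [(tendsto_finsetSum S fun z hz => hlim z hz w).liminf_eq]
      exact Finset.sum_congr rfl fun z _ => ENNReal.ofReal_mul (hφ0 z)
    simp_rw [this]
    rw [lintegral_finsetSum _ (fun z _ => by fun_prop), ENNReal.ofReal_sum_of_nonneg
      (fun z _ => by have := hφ0 z; positivity)]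
    refine Finset.sum_congr rfl fun z hz => ?_
    rw [lintegral_const_mul _ (by fun_prop), lintegral_power_density _ (hb z hz),
      ← ENNReal.ofReal_mul (hφ0 z), mul_comm]
  have hR : ∀ k, ∫⁻ w, ∑ z ∈ S, G z k w ≤ ENNReal.ofReal (A + A' * d k ^ 2) := fun k => by
    rw [lintegral_finsetSum _ (fun z _ => hGm z k)]
    simp_rw [hGint]
    rw [← lintegral_biUnion_finset hdisj (fun z _ => measurableSet_ball)]
    exact (setLIntegral_le_lintegral _ _).trans (hHint k)
  have hA0 : Tendsto (fun k => ENNReal.ofReal (A + A' * d k ^ 2)) atTop (𝓝 (ENNReal.ofReal A)) := by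
    refine ENNReal.tendsto_ofReal ?_
    simpa using ((hd0.pow 2).const_mul A').const_add A
  have hfin : ENNReal.ofReal (∑ z ∈ S, 2 * Real.pi * (m z + 1) * φ z) ≤ ENNReal.ofReal A := by
    rw [← hL]
    refine hfatou.trans ?_
    rw [← hA0.liminf_eq]
    exact liminf_le_liminf (.of_forall hR)
  rcases le_or_gt 0 A with h | h
  · exact (ENNReal.ofReal_le_ofReal_iff h).1 hfin
  · -- the left side of Green's identity is nonnegative, so `A` cannot be negative
    exfalso
    have h1 : ∀ k, 0 ≤ A + A' * d k ^ 2 := fun k => by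
      refine le_trans ?_ (hA _ (hdpos k))
      rw [integral_smoothLog_mul_planeLaplacian hφ hs hf (hdpos k)]
      exact integral_nonneg fun z => mul_nonneg (zeroDensity_nonneg _ _ _) (hφ0 z)
    have h2 : Tendsto (fun k => A + A' * d k ^ 2) atTop (𝓝 A) := by
      simpa using ((hd0.pow 2).const_mul A').const_add A
    exact absurd (ge_of_tendsto' h2 h1) (not_le.2 h)

end

/-! ### Jensen's inequality and the upper bound for the Green integral -/

section
open MeasureTheory Filter Topology

theorem continuousAt_smoothLog {f : ℂ → ℂ} {z : ℂ} (hf : ContinuousAt f z) {d : ℝ} (hd : 0 < d) :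
    ContinuousAt (smoothLog f d) z :=
  (((hf.norm.pow 2).add_const _).log
    (show ‖f z‖ ^ 2 + d ^ 2 ≠ 0 by positivity)).const_mul _

theorem log_norm_le_smoothLog {f : ℂ → ℂ} {z : ℂ} (hz : f z ≠ 0) (d : ℝ) :
    Real.log ‖f z‖ ≤ smoothLog f d z := by
  have h : 0 < ‖f z‖ := norm_pos_iff.2 hz
  have : Real.log (‖f z‖ ^ 2) ≤ Real.log (‖f z‖ ^ 2 + d ^ 2) :=
    Real.log_le_log (by positivity) (by nlinarith [sq_nonneg d])
  rw [Real.log_pow] at this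
  push_cast at this
  unfold smoothLog
  linarith

theorem smoothLog_le {f : ℂ → ℂ} {z : ℂ} {M : ℝ} (hM : 0 ≤ M) (h : Real.log ‖f z‖ ≤ M) {d : ℝ}
    (hd : 0 < d) : smoothLog f d z ≤ M + d ^ 2 := by
  have h1 : ‖f z‖ ≤ Real.exp M := by
    rcases eq_or_ne (f z) 0 with h0 | h0
    · simp [h0, Real.exp_nonneg]
    · rwa [Real.log_le_iff_le_exp (norm_pos_iff.2 h0)] at h
  have h2 : ‖f z‖ ^ 2 + d ^ 2 ≤ Real.exp M ^ 2 * (1 + d ^ 2) := by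
    have h3 : 1 ≤ Real.exp M := Real.one_le_exp hM
    have h4 : ‖f z‖ ^ 2 ≤ Real.exp M ^ 2 := by gcongr
    nlinarith [sq_nonneg d, mul_nonneg (sq_nonneg d) (show 0 ≤ Real.exp M ^ 2 - 1 by nlinarith)]
  have h3 : Real.log (‖f z‖ ^ 2 + d ^ 2) ≤ 2 * M + d ^ 2 := by
    refine (Real.log_le_log (by positivity) h2).trans ?_
    rw [Real.log_mul (by positivity) (by positivity), Real.log_pow, Real.log_exp]
    have := Real.log_le_sub_one_of_pos (show 0 < 1 + d ^ 2 by positivity)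
    push_cast
    linarith
  unfold smoothLog
  nlinarith [sq_nonneg d]

/-- Jensen's inequality for `½ log (|f|² + d²)` on circles. -/
theorem circleAverage_smoothLog_nonneg {f : ℂ → ℂ} (hf : AnalyticOnNhd ℂ f (Metric.ball 0 1))
    (hf0 : ‖f 0‖ = 1) {R : ℝ} (hR0 : 0 ≤ R) (hR1 : R < 1) {d : ℝ} (hd : 0 < d) :
    0 ≤ Real.circleAverage (smoothLog f d) 0 R := by
  have hne : f 0 ≠ 0 := by rw [← norm_ne_zero_iff, hf0]; exact one_ne_zero
  have hsub : Metric.closedBall (0 : ℂ) |R| ⊆ Metric.ball 0 1 :=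
    Metric.closedBall_subset_ball (by rwa [abs_of_nonneg hR0])
  rcases hR0.eq_or_lt with rfl | hR
  · rw [Real.circleAverage_zero]
    have := log_norm_le_smoothLog hne d
    rwa [hf0, Real.log_one] at this
  have hci : CircleIntegrable (smoothLog f d) 0 R := by
    refine ContinuousOn.circleIntegrable' fun z hz => ?_
    exact (continuousAt_smoothLog
      (hf z (hsub (Metric.sphere_subset_closedBall hz))).continuousAt hd).continuousWithinAt
  have hmer : MeromorphicOn f (Metric.sphere 0 |R|) :=
    ((hf.mono hsub).mono Metric.sphere_subset_closedBall).meromorphicOn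
  -- at the zeros of `f` the value `Real.log 0 = 0` is replaced, which changes no average
  set g : ℂ → ℝ := fun z => if f z = 0 then smoothLog f d z else Real.log ‖f z‖ with hg
  have hcod : (fun z => Real.log ‖f z‖) =ᶠ[codiscreteWithin (Metric.sphere (0 : ℂ) |R|)] g := by
    have h1 := hf.preimage_zero_mem_codiscreteWithin hne
      (Metric.mem_ball_self one_pos)
      ((convex_ball (0 : ℂ) 1).isConnected ⟨0, Metric.mem_ball_self one_pos⟩)
    have h2 := codiscreteWithin_mono (Metric.sphere_subset_closedBall.trans hsub) h1
    filter_upwards [h2] with z hz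
    have : f z ≠ 0 := by simpa using hz
    simp [hg, this]
  have hjensen : 0 ≤ Real.circleAverage (fun z => Real.log ‖f z‖) 0 R := by
    rw [(hf.mono hsub).circleAverage_log_norm hR.ne' hne, hf0, Real.log_one, add_zero]
    refine finsum_nonneg fun u => ?_
    by_cases hu : u ∈ Metric.closedBall (0 : ℂ) |R|
    · have h1 : 0 ≤ MeromorphicOn.divisor f (Metric.closedBall (0 : ℂ) |R|) u :=
        MeromorphicOn.AnalyticOnNhd.divisor_nonneg (hf.mono hsub) u
      refine mul_nonneg (by exact_mod_cast h1) ?_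
      rcases eq_or_ne u 0 with rfl | hu0
      · simp
      · refine Real.log_nonneg ?_
        rw [zero_sub, norm_neg, ← div_eq_mul_inv, one_le_div (norm_pos_iff.2 hu0)]
        rw [mem_closedBall_zero_iff, abs_of_pos hR] at hu
        exact hu
    · rw [Function.locallyFinsuppWithin.apply_eq_zero_of_notMem _ hu]
      simp
  refine hjensen.trans ?_
  rw [Real.circleAverage_congr_codiscreteWithin hcod hR.ne']
  refine Real.circleAverage_mono ?_ hci fun z hz => ?_
  · exact (circleIntegrable_congr_codiscreteWithin hcod).1 hmer.circleIntegrable_log_norm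
  · simp only [hg]
    split_ifs with h
    · exact le_rfl
    · exact log_norm_le_smoothLog h d

/-- A function whose averages over all origin-centred circles are nonnegative has nonnegative
integral over origin-centred discs. -/
theorem integral_closedBall_nonneg_of_circleAverage_nonneg {u : ℂ → ℝ} {R : ℝ}
    (hu : ContinuousOn u (Metric.closedBall 0 R))
    (h : ∀ r, 0 ≤ r → r ≤ R → 0 ≤ Real.circleAverage u 0 r) :
    0 ≤ ∫ z in Metric.closedBall (0 : ℂ) R, u z := by
  set B := Metric.closedBall (0 : ℂ) R with hB
  -- average the integral over all rotations of the disc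
  have hrot : ∀ θ : ℝ, ∫ z in B, u (Circle.exp θ * z) = ∫ z in B, u z := fun θ => by
    have hmp := (rotation (Circle.exp θ)).measurePreserving
    have := hmp.setIntegral_preimage_emb
      (rotation (Circle.exp θ)).toHomeomorph.measurableEmbedding u B
    have hpre : (rotation (Circle.exp θ)) ⁻¹' B = B := by
      ext z
      simp only [Set.mem_preimage, hB, mem_closedBall_zero_iff, LinearIsometryEquiv.norm_map]
    rw [hpre] at this
    simpa using this
  have hint : Integrable (fun p : ℝ × ℂ => u (Circle.exp p.1 * p.2))
      ((volume.restrict (Set.Icc 0 (2 * Real.pi))).prod (volume.restrict B)) := by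
    rw [Measure.prod_restrict]
    refine ContinuousOn.integrableOn_compact (isCompact_Icc.prod (isCompact_closedBall _ _)) ?_
    refine hu.comp (by fun_prop) fun p hp => ?_
    have := hp.2
    simpa [hB] using this
  have hswap := integral_integral_swap
    (f := fun (θ : ℝ) (z : ℂ) => u (Circle.exp θ * z)) hint
  simp only [hrot] at hswap
  rw [integral_const] at hswap
  have hnonneg : 0 ≤ ∫ z in B, ∫ θ in Set.Icc 0 (2 * Real.pi), u (Circle.exp θ * z) := by
    refine setIntegral_nonneg Metric.isClosed_closedBall.measurableSet fun z hz => ?_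
    have h1 := h ‖z‖ (norm_nonneg z) (by simpa [hB] using hz)
    rw [Real.circleAverage_eq_integral_add z.arg, smul_eq_mul] at h1
    have h2 := (mul_nonneg_iff_of_pos_left (by positivity : (0 : ℝ) < (2 * Real.pi)⁻¹)).1 h1
    rw [integral_Icc_eq_integral_Ioc, ← intervalIntegral.integral_of_le (by positivity)]
    refine h2.trans_eq ?_
    congr 1
    ext θ
    congr 1
    rw [circleMap_zero, Circle.coe_exp]
    conv_rhs => rw [← Complex.norm_mul_exp_arg_mul_I z]
    push_cast
    rw [add_mul, Complex.exp_add]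
    ring
  rw [← hswap] at hnonneg
  simp only [measureReal_restrict_apply_univ, Real.volume_real_Icc, sub_zero, smul_eq_mul] at hnonneg
  exact (mul_nonneg_iff_of_pos_left (by positivity)).1 hnonneg

/-- If `log |f| ≤ M` in the disc and `-C₀ ≤ Δφ`, with `Δφ ≥ 0` off a smaller disc, then the integral
of `½ log (|f|² + d²) Δφ` is controlled by `M` alone: on the smaller disc Jensen's inequality bounds
the negative part of `log |f|` by its positive part. -/
theorem integral_smoothLog_mul_planeLaplacian_le {f : ℂ → ℂ}
    (hf : AnalyticOnNhd ℂ f (Metric.ball 0 1)) (hf0 : ‖f 0‖ = 1) {φ M W : ℂ → ℝ}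
    (hφ : ContDiff ℝ 2 φ) (hs : HasCompactSupport φ) (hsub : tsupport φ ⊆ Metric.ball 0 1)
    (hM0 : ∀ z ∈ Metric.ball (0 : ℂ) 1, 0 ≤ M z)
    (hM : ∀ z ∈ Metric.ball (0 : ℂ) 1, Real.log ‖f z‖ ≤ M z)
    {R C₀ : ℝ} (hR : R < 1) (hC₀ : 0 ≤ C₀)
    (hlow : ∀ z ∈ Metric.closedBall (0 : ℂ) R, -C₀ ≤ planeLaplacian φ z)
    (hpos : ∀ z ∈ Metric.ball (0 : ℂ) 1, R < ‖z‖ → 0 ≤ planeLaplacian φ z)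
    (hW0 : ∀ z ∈ Metric.ball (0 : ℂ) 1, |planeLaplacian φ z| ≤ W z)
    (hW1 : ∀ z ∈ Metric.closedBall (0 : ℂ) R, |planeLaplacian φ z| + C₀ ≤ W z)
    (hWi : IntegrableOn W (Metric.ball 0 1))
    (hMW : IntegrableOn (fun z => M z * W z) (Metric.ball 0 1)) {d : ℝ} (hd : 0 < d) :
    ∫ z, smoothLog f d z * planeLaplacian φ z ≤
      (∫ z in Metric.ball (0 : ℂ) 1, M z * W z) + (∫ z in Metric.ball (0 : ℂ) 1, W z) * d ^ 2 := by
  set B := Metric.closedBall (0 : ℂ) R with hB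
  have hBsub : B ⊆ Metric.ball (0 : ℂ) 1 := Metric.closedBall_subset_ball hR
  have hcont : ∀ z ∈ Metric.ball (0 : ℂ) 1, ContinuousAt (smoothLog f d) z := fun z hz =>
    continuousAt_smoothLog (hf z hz).continuousAt hd
  have hcontB : ContinuousOn (smoothLog f d) B := fun z hz =>
    (hcont z (hBsub hz)).continuousWithinAt
  have hcore : 0 ≤ ∫ z in B, smoothLog f d z :=
    integral_closedBall_nonneg_of_circleAverage_nonneg hcontB fun r hr0 hr1 =>
      circleAverage_smoothLog_nonneg hf hf0 hr0 (hr1.trans_lt hR) hd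
  have hi1 : Integrable fun z => smoothLog f d z * planeLaplacian φ z :=
    integrable_mul_of_continuousAt_tsupport hφ.continuous_planeLaplacian hs.planeLaplacian
      fun z hz => hcont z (hsub (tsupport_planeLaplacian_subset φ hz))
  have hBm : MeasurableSet B := Metric.isClosed_closedBall.measurableSet
  have hi2 : Integrable (B.indicator fun z => C₀ * smoothLog f d z) := by
    rw [integrable_indicator_iff hBm]
    exact (hcontB.integrableOn_compact (isCompact_closedBall _ _)).const_mul C₀
  have hle : ∫ z, smoothLog f d z * planeLaplacian φ z ≤
      ∫ z, (smoothLog f d z * planeLaplacian φ z + B.indicator (fun z => C₀ * smoothLog f d z) z) := by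
    rw [integral_add hi1 hi2, integral_indicator hBm, integral_const_mul]
    have := mul_nonneg hC₀ hcore
    linarith
  refine hle.trans ?_
  have hoff : ∀ z, z ∉ Metric.ball (0 : ℂ) 1 → smoothLog f d z * planeLaplacian φ z +
      B.indicator (fun z => C₀ * smoothLog f d z) z = 0 := fun z hz => by
    rw [Set.indicator_of_notMem (fun h => hz (hBsub h)),
      image_eq_zero_of_notMem_tsupport
        (fun h => hz (hsub (tsupport_planeLaplacian_subset φ h)))]
    simp
  rw [← setIntegral_eq_integral_of_forall_compl_eq_zero hoff, ← integral_mul_const,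
    ← integral_add hMW (hWi.mul_const _)]
  refine setIntegral_mono_on (hi1.add hi2).integrableOn (hMW.add (hWi.mul_const _))
    measurableSet_ball fun z hz => ?_
  have hu : smoothLog f d z ≤ M z + d ^ 2 := smoothLog_le (hM0 z hz) (hM z hz) hd
  have hMd : 0 ≤ M z + d ^ 2 := add_nonneg (hM0 z hz) (sq_nonneg d)
  have hWz := hW0 z hz
  have habs := le_abs_self (planeLaplacian φ z)
  have key : ∀ t, 0 ≤ t → t ≤ W z → smoothLog f d z * t ≤ M z * W z + W z * d ^ 2 := by
    intro t ht htW
    calc smoothLog f d z * t ≤ (M z + d ^ 2) * t := by gcongr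
      _ ≤ (M z + d ^ 2) * W z := by gcongr
      _ = _ := by ring
  by_cases hzB : z ∈ B
  · rw [Set.indicator_of_mem hzB]
    have := key (planeLaplacian φ z + C₀) (by linarith [hlow z hzB])
      (by linarith [hW1 z hzB])
    linarith
  · rw [Set.indicator_of_notMem hzB, add_zero]
    exact key _ (hpos z hz (by simpa [hB] using hzB)) (by linarith)

end

/-! ### The inequality behind subharmonicity, and the cutoff -/

/-- The real-variable inequality behind subharmonicity of the test function. Here `y = 1 - |z|²`,
`ρ = |z - e|` and `D = ρ + B y`; `n = t / (y - t)` measures the effect of the cutoff at height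
`t`, and `L` is the logarithmic derivative with respect to `log y` of the cut-off power of `y`;
`NN` is `|∇D|²`, `I = ∇y · ∇D`, `PG` and `NG` are the products of `∇y` and `∇D` with the gradient
of the harmonic factor, and `GG ≥ 0` its squared length. -/
theorem subharmonicity_inequality {y ρ B D r a ε n L NN I PG NG GG cN C₁ : ℝ}
    (hy : 0 < y) (hy2 : y ≤ 1 / 2) (hρ : 0 < ρ) (hyρ : y ≤ 2 * ρ) (hB : 0 < B)
    (hD : D = ρ + B * y) (hr : 0 ≤ r) (hε : 0 < ε) (hε1 : ε ≤ 1) (har : 1 + ε ≤ a - r)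
    (hn : 0 ≤ n) (hL : L = a + 3 * n)
    (hNN : NN = 1 + 2 * B * ((y - ρ ^ 2) / ρ) + 4 * B ^ 2 * (1 - y))
    (hI : I = (y - ρ ^ 2) / ρ + 4 * B * (1 - y))
    (hcN : 0 ≤ cN) (hPG : -cN ≤ PG) (hC₁ : 0 ≤ C₁) (hNG : y / D * NG ≤ C₁) (hGG : 0 ≤ GG)
    (hBbig : 2 * (2 * r + 4 * r * (a + 3)) ≤ B * ε)
    (hysmall : y * ((4 + 2 * cN) * (a + 3) + 2 * r * (1 + r) + 2 * r * C₁) ≤ ε / 2) :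
    0 ≤ -4 * L * y - 4 * (1 - y) * (a + 6 * n + 3 * n ^ 2) - r * (y ^ 2 * (1 / ρ - 4 * B) / D)
      + r * (y ^ 2 * NN / D ^ 2) + (4 * (1 - y) * L ^ 2 + r ^ 2 * (y ^ 2 * NN / D ^ 2)
      - 2 * L * r * (y * I / D) + 2 * L * y * PG - 2 * r * y * (y / D * NG) + y ^ 2 * GG) := by
  have hDpos : 0 < D := by rw [hD]; positivity
  have hρD : ρ ≤ D := by rw [hD]; nlinarith
  have hByD : B * y ≤ D := by rw [hD]; linarith
  set τ := B * y / D with hτ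
  have hτ0 : 0 ≤ τ := by positivity
  have hτ1 : τ ≤ 1 := by rw [hτ, div_le_one hDpos]; exact hByD
  -- `y² / (ρ D) ≤ 2 / B`
  have hσ : y ^ 2 / (ρ * D) ≤ 2 / B := by
    rw [div_le_div_iff₀ (by positivity) hB]
    calc y ^ 2 * B = y * (B * y) := by ring
      _ ≤ (2 * ρ) * D := by gcongr
      _ = 2 * (ρ * D) := by ring
  have hσ0 : 0 ≤ y ^ 2 / (ρ * D) := by positivity
  have e1 : y ^ 2 * (1 / ρ - 4 * B) / D = y ^ 2 / (ρ * D) - 4 * y * τ := by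
    rw [hτ]; field_simp
  have e2 : y * I / D = y ^ 2 / (ρ * D) - y * ρ / D + 4 * (1 - y) * τ := by
    rw [hτ, hI]; field_simp
  have hyρD : 0 ≤ y * ρ / D := by positivity
  have e3 : 4 * (1 - y) * τ ^ 2 - 2 * y ≤ y ^ 2 * NN / D ^ 2 := by
    have : y ^ 2 * NN / D ^ 2 =
        (y / D) ^ 2 * (1 + 2 * B * (y / ρ)) - 2 * y * (τ * (ρ / D)) + 4 * (1 - y) * τ ^ 2 := by
      rw [hτ, hNN]; field_simp; ring
    rw [this]
    have h1 : 0 ≤ (y / D) ^ 2 * (1 + 2 * B * (y / ρ)) := by positivity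
    have h2 : τ * (ρ / D) ≤ 1 := by
      have : ρ / D ≤ 1 := (div_le_one hDpos).2 hρD
      exact mul_le_one₀ hτ1 (by positivity) this
    linarith [mul_le_mul_of_nonneg_left h2 hy.le]
  have ha : 0 < a := by linarith
  have hL0 : 0 ≤ L := by rw [hL]; positivity
  -- the main term
  have hmain : ε + 6 * n ^ 2 ≤ L ^ 2 - a - 6 * n - 3 * n ^ 2 + r * (1 + r) * τ ^ 2
      - 2 * L * r * τ := by
    have hX : 1 + ε + r * (1 - τ) ≤ a - r * τ := by linarith
    have h1 : 0 ≤ r * (1 - τ) := mul_nonneg hr (by linarith)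
    have h2 : ε + r * τ * (1 - τ) ≤ (a - r * τ) * (a - r * τ - 1) := by
      have : (1 + ε + r * (1 - τ)) * (ε + r * (1 - τ)) ≤ (a - r * τ) * (a - r * τ - 1) := by
        apply mul_le_mul hX (by linarith) (by positivity) (by linarith)
      refine le_trans ?_ this
      have h3 : 0 ≤ r * (1 - τ) * (1 - τ) := mul_nonneg h1 (by linarith)
      have h4 : 0 ≤ r * (1 - τ) * ε := mul_nonneg h1 hε.le
      have h5 : (1 + ε + r * (1 - τ)) * (ε + r * (1 - τ)) = ε + r * τ * (1 - τ) + ε ^ 2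
          + r * (1 - τ) * (1 - τ) + 2 * (r * (1 - τ) * ε) + (r * (1 - τ)) ^ 2 := by ring
      rw [h5]
      linarith [sq_nonneg ε, sq_nonneg (r * (1 - τ))]
    have h3 : 0 ≤ n * (a - 1 - r * τ) := mul_nonneg hn (by linarith)
    have h4 : L ^ 2 - a - 6 * n - 3 * n ^ 2 + r * (1 + r) * τ ^ 2 - 2 * L * r * τ =
        (a - r * τ) * (a - r * τ - 1) - r * τ * (1 - τ) + 6 * (n * (a - 1 - r * τ))
          + 6 * n ^ 2 := by
      rw [hL]; ring
    rw [h4]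
    linarith
  have hmain2 : 2 * (ε + 6 * n ^ 2) ≤ 4 * (1 - y) * (L ^ 2 - a - 6 * n - 3 * n ^ 2
      + r * (1 + r) * τ ^ 2 - 2 * L * r * τ) := by
    have h0 : 0 ≤ ε + 6 * n ^ 2 := by positivity
    calc 2 * (ε + 6 * n ^ 2) ≤ 4 * (1 - y) * (ε + 6 * n ^ 2) := by gcongr; linarith
      _ ≤ _ := by
        have : 0 ≤ 4 * (1 - y) := by linarith
        exact mul_le_mul_of_nonneg_left hmain this
  have hLn : L ≤ (a + 3) * (1 + n ^ 2) := by
    have h1 : 0 ≤ a * n ^ 2 := by positivity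
    rw [hL]; linarith [sq_nonneg (n - 1), sq_nonneg (n + 1), sq_nonneg n]
  have hn1 : 1 ≤ 1 + n ^ 2 := by linarith [sq_nonneg n]
  -- the errors that are small because `B` is large
  have hBerr : (2 * r + 4 * L * r) / B ≤ ε / 2 * (1 + n ^ 2) := by
    rw [div_le_iff₀ hB]
    have : 2 * r + 4 * L * r ≤ (2 * r + 4 * r * (a + 3)) * (1 + n ^ 2) := by
      linarith [mul_le_mul_of_nonneg_left hLn hr, mul_le_mul_of_nonneg_left hn1 hr]
    linarith [mul_le_mul_of_nonneg_right hBbig (by linarith : 0 ≤ 1 + n ^ 2)]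
  -- the errors that are small because `y` is small
  have hyerr : y * (4 * L + 2 * r * (1 + r) + 2 * L * cN + 2 * r * C₁) ≤ ε / 2 * (1 + n ^ 2) := by
    have h1 : 4 * L + 2 * r * (1 + r) + 2 * L * cN + 2 * r * C₁ ≤
        ((4 + 2 * cN) * (a + 3) + 2 * r * (1 + r) + 2 * r * C₁) * (1 + n ^ 2) := by
      have := mul_le_mul_of_nonneg_left hLn (by positivity : 0 ≤ 4 + 2 * cN)
      have := mul_le_mul_of_nonneg_left hn1 (by positivity : 0 ≤ 2 * r * (1 + r) + 2 * r * C₁)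
      linarith
    calc _ ≤ y * (((4 + 2 * cN) * (a + 3) + 2 * r * (1 + r) + 2 * r * C₁) * (1 + n ^ 2)) := by
          gcongr
      _ = y * ((4 + 2 * cN) * (a + 3) + 2 * r * (1 + r) + 2 * r * C₁) * (1 + n ^ 2) := by ring
      _ ≤ _ := by gcongr
  have t1 : -(r * (2 / B)) ≤ -(r * (y ^ 2 * (1 / ρ - 4 * B) / D)) := by
    rw [e1]
    linarith [mul_le_mul_of_nonneg_left hσ hr, mul_nonneg hr (mul_nonneg hy.le hτ0)]
  have t2 := mul_le_mul_of_nonneg_left e3 (by positivity : 0 ≤ r * (1 + r))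
  have t3 : 2 * L * r * (y * I / D) ≤ 2 * L * r * (2 / B + 4 * (1 - y) * τ) := by
    rw [e2]; gcongr; linarith
  have t4 : -(2 * L * y * cN) ≤ 2 * L * y * PG := by
    linarith [mul_le_mul_of_nonneg_left hPG (by positivity : 0 ≤ 2 * L * y)]
  have t5 : 2 * r * y * (y / D * NG) ≤ 2 * r * y * C₁ := by gcongr
  have t6 : 0 ≤ y ^ 2 * GG := by positivity
  have t7 : (2 * r + 4 * L * r) / B = r * (2 / B) + 2 * L * r * (2 / B) := by ring
  have hε2 : ε * n ^ 2 ≤ n ^ 2 := mul_le_of_le_one_left (sq_nonneg n) hε1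
  linarith [sq_nonneg n]

theorem hasDerivAt_max_zero_pow (n : ℕ) (x : ℝ) :
    HasDerivAt (fun x : ℝ => max x 0 ^ (n + 2)) ((n + 2) * max x 0 ^ (n + 1)) x := by
  rcases lt_trichotomy x 0 with h | rfl | h
  · have e : (fun x : ℝ => max x 0 ^ (n + 2)) =ᶠ[nhds x] fun _ => 0 := by
      filter_upwards [eventually_lt_nhds h] with w hw
      simp [max_eq_right hw.le]
    rw [max_eq_right h.le, zero_pow (by omega), mul_zero]
    exact (hasDerivAt_const x 0).congr_of_eventuallyEq e
  · rw [max_self, zero_pow (by omega), mul_zero, hasDerivAt_iff_isLittleO]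
    have h1 : (fun x : ℝ => max x 0 ^ (n + 2)) =O[nhds 0] fun x : ℝ => x ^ (n + 2) := by
      refine Asymptotics.isBigO_of_le _ fun x => ?_
      rw [norm_pow, norm_pow]
      gcongr
      rw [Real.norm_of_nonneg (le_max_right _ _)]
      exact max_le (le_abs_self x) (abs_nonneg x)
    have h2 : (fun x : ℝ => x ^ (n + 2)) =o[nhds 0] fun x : ℝ => x := by
      simpa using Asymptotics.isLittleO_pow_id (𝕜 := ℝ) (n := n + 2) (by omega)
    simpa using h1.trans_isLittleO h2
  · have e : (fun x : ℝ => max x 0 ^ (n + 2)) =ᶠ[nhds x] fun x => x ^ (n + 2) := by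
      filter_upwards [eventually_gt_nhds h] with w hw
      simp [max_eq_left hw.le]
    rw [max_eq_left h.le]
    refine ((hasDerivAt_pow (n + 2) x).congr_of_eventuallyEq e).congr_deriv ?_
    push_cast
    simp

theorem contDiff_max_zero_pow_three : ContDiff ℝ 2 fun x : ℝ => max x 0 ^ 3 := by
  have d3 : deriv (fun x : ℝ => max x 0 ^ 3) = fun x => 3 * max x 0 ^ 2 := by
    ext x
    rw [(hasDerivAt_max_zero_pow 1 x).deriv]
    norm_num
  have d2 : deriv (fun x : ℝ => 3 * max x 0 ^ 2) = fun x => 6 * max x 0 := by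
    ext x
    rw [((hasDerivAt_max_zero_pow 0 x).const_mul 3).deriv]
    norm_num; ring
  rw [show (2 : WithTop ℕ∞) = 1 + 1 by norm_num, contDiff_succ_iff_deriv]
  refine ⟨fun x => (hasDerivAt_max_zero_pow 1 x).differentiableAt, by simp, ?_⟩
  rw [d3, show (1 : WithTop ℕ∞) = 0 + 1 by norm_num, contDiff_succ_iff_deriv]
  refine ⟨fun x => ((hasDerivAt_max_zero_pow 0 x).const_mul 3).differentiableAt, by simp, ?_⟩
  rw [d2, contDiff_zero]
  fun_prop

/-! ### The test function and its gradients -/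

section
open Finset

/-- A substitute for the distance to the boundary point `e` that stays comparable to it in the disc
but dominates a large multiple of `1 - |z|²`. -/
noncomputable def thickDist (B : ℝ) (e z : ℂ) : ℝ := ‖z - e‖ + B * (1 - ‖z‖ ^ 2)

/-- The logarithm of `(1 - |z|²) ^ (a - 3) * ∏ |z - b| ^ c * thickDist ^ (-r)`. -/
noncomputable def logWeight (a r c B : ℝ) (e : ℂ) (F : Finset ℂ) (z : ℂ) : ℝ :=
  (a - 3) * Real.log (1 - ‖z‖ ^ 2) + c * ∑ b ∈ F, Real.log ‖z - b‖
    + -r * Real.log (thickDist B e z)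

/-- The test function: `(1 - |z|²) ^ a * ∏ |z - b| ^ c * thickDist ^ (-r)`, with three of the
factors `1 - |z|²` cut off at height `t` to make the support compact. -/
noncomputable def testFunction (a r c B : ℝ) (e : ℂ) (F : Finset ℂ) (t : ℝ) (z : ℂ) : ℝ :=
  max (1 - ‖z‖ ^ 2 - t) 0 ^ 3 * Real.exp (logWeight a r c B e F z)

variable {a r c B : ℝ} {e : ℂ} {F : Finset ℂ} {t : ℝ} {z : ℂ}

theorem one_sub_norm_sq_pos (hz : ‖z‖ < 1) : 0 < 1 - ‖z‖ ^ 2 := by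
  nlinarith [norm_nonneg z]

theorem ne_of_norm_lt_one (hz : ‖z‖ < 1) (he : ‖e‖ = 1) : z ≠ e := by
  rintro rfl; exact absurd hz (by rw [he]; exact lt_irrefl _)

theorem norm_sub_pos_of_norm_lt_one (hz : ‖z‖ < 1) (he : ‖e‖ = 1) : 0 < ‖z - e‖ :=
  norm_pos_iff.2 (sub_ne_zero.2 (ne_of_norm_lt_one hz he))

theorem one_sub_norm_sq_le (hz : ‖z‖ < 1) (he : ‖e‖ = 1) : 1 - ‖z‖ ^ 2 ≤ 2 * ‖z - e‖ := by
  have h1 : ‖e‖ ≤ ‖z‖ + ‖z - e‖ := by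
    have := norm_sub_le z (z - e)
    rwa [sub_sub_cancel] at this
  nlinarith [norm_nonneg z]

theorem thickDist_pos (hB : 0 < B) (hz : ‖z‖ < 1) (he : ‖e‖ = 1) : 0 < thickDist B e z :=
  add_pos (norm_sub_pos_of_norm_lt_one hz he) (mul_pos hB (one_sub_norm_sq_pos hz))

/-- The gradient of `thickDist`. -/
noncomputable def thickDistGrad (B : ℝ) (e z : ℂ) : ℂ := ‖z - e‖⁻¹ • (z - e) + (-2 * B) • z

/-- The gradient of `c * ∑ log |z - b|`. -/
noncomputable def harmonicGrad (c : ℝ) (F : Finset ℂ) (z : ℂ) : ℂ :=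
  c • ∑ b ∈ F, (‖z - b‖ ^ 2)⁻¹ • (z - b)

theorem hasJet_thickDist (hz : ‖z‖ < 1) (he : ‖e‖ = 1) :
    HasJet (thickDist B e) z (thickDistGrad B e z) (1 / ‖z - e‖ - 4 * B) := by
  refine ((hasJet_norm_sub (ne_of_norm_lt_one hz he)).add
    ((hasJet_one_sub_norm_sq z).const_mul B)).congr_val ?_ ?_
  · simp only [thickDistGrad, Complex.real_smul]; push_cast; ring
  · ring

theorem hasJet_harmonic (hz : ‖z‖ < 1) (hF : ∀ b ∈ F, ‖b‖ = 1) :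
    HasJet (fun w => c * ∑ b ∈ F, Real.log ‖w - b‖) z (harmonicGrad c F z) 0 := by
  refine ((HasJet.sum F fun b hb =>
    hasJet_log_norm_sub (ne_of_norm_lt_one hz (hF b hb))).const_mul c).congr_val ?_ (by simp)
  simp only [harmonicGrad, Complex.real_smul]
  congr 1
  refine sum_congr rfl fun b _ => ?_
  push_cast; ring

theorem hasJet_logWeight (hB : 0 < B) (hz : ‖z‖ < 1) (he : ‖e‖ = 1) (hF : ∀ b ∈ F, ‖b‖ = 1) :
    HasJet (logWeight a r c B e F) z
      (((a - 3) / (1 - ‖z‖ ^ 2)) • ((-2 : ℝ) • z) + harmonicGrad c F z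
        - (r / thickDist B e z) • thickDistGrad B e z)
      ((a - 3) * (-4 / (1 - ‖z‖ ^ 2) - 4 * ‖z‖ ^ 2 / (1 - ‖z‖ ^ 2) ^ 2)
        - r * ((1 / ‖z - e‖ - 4 * B) / thickDist B e z
          - ‖thickDistGrad B e z‖ ^ 2 / thickDist B e z ^ 2)) := by
  have h1 := ((hasJet_one_sub_norm_sq z).log (one_sub_norm_sq_pos hz).ne').const_mul (a - 3)
  have h2 := hasJet_harmonic (c := c) hz hF
  have h3 := ((hasJet_thickDist (B := B) hz he).log (thickDist_pos hB hz he).ne').const_mul (-r)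
  refine ((h1.add h2).add h3).congr_val ?_ ?_
  · simp only [Complex.real_smul]; push_cast; ring
  · simp only [norm_mul, norm_neg, Complex.norm_ofNat]; ring

theorem hasJet_log_testFunction (hB : 0 < B) (hz : ‖z‖ < 1) (he : ‖e‖ = 1)
    (hF : ∀ b ∈ F, ‖b‖ = 1) (ht : t < 1 - ‖z‖ ^ 2) :
    HasJet (fun w => 3 * Real.log (1 - ‖w‖ ^ 2 - t) + logWeight a r c B e F w) z
      ((3 / (1 - ‖z‖ ^ 2 - t) + (a - 3) / (1 - ‖z‖ ^ 2)) • ((-2 : ℝ) • z) + harmonicGrad c F z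
        - (r / thickDist B e z) • thickDistGrad B e z)
      (3 * (-4 / (1 - ‖z‖ ^ 2 - t) - 4 * ‖z‖ ^ 2 / (1 - ‖z‖ ^ 2 - t) ^ 2)
        + (a - 3) * (-4 / (1 - ‖z‖ ^ 2) - 4 * ‖z‖ ^ 2 / (1 - ‖z‖ ^ 2) ^ 2)
        - r * ((1 / ‖z - e‖ - 4 * B) / thickDist B e z
          - ‖thickDistGrad B e z‖ ^ 2 / thickDist B e z ^ 2)) := by
  have h0 := (hasJet_one_sub_norm_sq z).add (HasJet.const (-t))
  have h1 := (h0.log (show 1 - ‖z‖ ^ 2 + -t ≠ 0 by linarith)).const_mul 3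
  refine ((h1.add (hasJet_logWeight (a := a) (r := r) (c := c) hB hz he hF)).congr
    (.of_eq ?_)).congr_val ?_ ?_
  · ext w; simp only [sub_eq_add_neg]
  · simp only [Complex.real_smul]; push_cast; ring
  · simp only [norm_mul, norm_neg, Complex.norm_ofNat, ← sub_eq_add_neg, add_zero]; ring

theorem inner_self_sub (he : ‖e‖ = 1) :
    inner ℝ z (z - e) = (‖z - e‖ ^ 2 - (1 - ‖z‖ ^ 2)) / 2 := by
  have := norm_sub_sq_real z (z - e)
  rw [sub_sub_cancel, he] at this
  linarith

theorem norm_thickDistGrad_sq (hz : ‖z‖ < 1) (he : ‖e‖ = 1) :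
    ‖thickDistGrad B e z‖ ^ 2 = 1 + 2 * B * (((1 - ‖z‖ ^ 2) - ‖z - e‖ ^ 2) / ‖z - e‖)
      + 4 * B ^ 2 * (1 - (1 - ‖z‖ ^ 2)) := by
  have h := norm_sub_pos_of_norm_lt_one hz he
  rw [thickDistGrad, norm_add_sq_real, inner_smul_left, inner_smul_right, real_inner_comm,
    inner_self_sub he, norm_smul, norm_smul, norm_inv, norm_norm, mul_pow, mul_pow, Real.norm_eq_abs,
    sq_abs]
  simp only [conj_trivial]
  field_simp
  ring

theorem inner_grad_thickDistGrad (hz : ‖z‖ < 1) (he : ‖e‖ = 1) :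
    inner ℝ ((-2 : ℝ) • z) (thickDistGrad B e z) =
      ((1 - ‖z‖ ^ 2) - ‖z - e‖ ^ 2) / ‖z - e‖ + 4 * B * (1 - (1 - ‖z‖ ^ 2)) := by
  have h := norm_sub_pos_of_norm_lt_one hz he
  rw [thickDistGrad, inner_add_right, inner_smul_left, inner_smul_left, inner_smul_right,
    inner_smul_right, inner_self_sub he, real_inner_self_eq_norm_sq]
  simp only [conj_trivial]
  field_simp
  ring

theorem norm_thickDistGrad_le (hB : 0 ≤ B) (hz : ‖z‖ < 1) (he : ‖e‖ = 1) :
    ‖thickDistGrad B e z‖ ≤ 1 + 2 * B := by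
  have h := norm_sub_pos_of_norm_lt_one hz he
  refine (norm_add_le _ _).trans ?_
  rw [norm_smul, norm_smul, norm_inv, norm_norm, inv_mul_cancel₀ h.ne', Real.norm_eq_abs,
    abs_mul, abs_of_nonneg hB]
  norm_num
  nlinarith

/-- Along the gradient of `1 - |z|²` the function `c * ∑ log |z - b|` decreases at a bounded rate,
although its gradient is unbounded: the singular part has the favourable sign. -/
theorem inner_grad_harmonicGrad (hc : 0 ≤ c) (hz : ‖z‖ < 1) (hF : ∀ b ∈ F, ‖b‖ = 1) :
    -(c * F.card) ≤ inner ℝ ((-2 : ℝ) • z) (harmonicGrad c F z) := by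
  rw [harmonicGrad, inner_smul_left, inner_smul_right, inner_sum, mul_left_comm, mul_sum,
    ← mul_neg]
  refine mul_le_mul_of_nonneg_left ?_ hc
  rw [show -(F.card : ℝ) = ∑ b ∈ F, (-1 : ℝ) by simp]
  refine sum_le_sum fun b hb => ?_
  have h := norm_sub_pos_of_norm_lt_one hz (hF b hb)
  have hy := one_sub_norm_sq_pos hz
  rw [inner_smul_right, inner_self_sub (hF b hb)]
  simp only [conj_trivial]
  have : -2 * ((‖z - b‖ ^ 2)⁻¹ * ((‖z - b‖ ^ 2 - (1 - ‖z‖ ^ 2)) / 2)) =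
      -1 + (1 - ‖z‖ ^ 2) / ‖z - b‖ ^ 2 := by
    field_simp; ring
  rw [this]
  have : 0 ≤ (1 - ‖z‖ ^ 2) / ‖z - b‖ ^ 2 := by positivity
  linarith

theorem mul_norm_harmonicGrad_le {q C : ℝ} (hc : 0 ≤ c) (hq : 0 ≤ q)
    (hz : ‖z‖ < 1) (hF : ∀ b ∈ F, ‖b‖ = 1) (h : ∀ b ∈ F, q ≤ C * ‖z - b‖) :
    q * ‖harmonicGrad c F z‖ ≤ C * (c * F.card) := by
  rw [harmonicGrad, norm_smul, Real.norm_of_nonneg hc]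
  have h1 : q * ‖∑ b ∈ F, (‖z - b‖ ^ 2)⁻¹ • (z - b)‖ ≤ ∑ b ∈ F, C := by
    refine (mul_le_mul_of_nonneg_left (norm_sum_le _ _) hq).trans ?_
    rw [mul_sum]
    refine sum_le_sum fun b hb => ?_
    have hp := norm_sub_pos_of_norm_lt_one hz (hF b hb)
    rw [norm_smul, norm_inv, norm_pow, norm_norm]
    have : q * ((‖z - b‖ ^ 2)⁻¹ * ‖z - b‖) = q / ‖z - b‖ := by field_simp
    rw [this, div_le_iff₀ hp]
    exact h b hb
  rw [sum_const, nsmul_eq_mul] at h1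
  nlinarith [mul_le_mul_of_nonneg_left h1 hc]

/-- Near `b` the factor `1 - |z|² ≤ 2 |z - b|` compensates the gradient of `log |z - b|`; near `e`,
where only `1 - |z|² ≤ thickDist` is available, that gradient is bounded. -/
theorem mul_norm_harmonicGrad_div_thickDist_le (hc : 0 ≤ c) (hB : 1 ≤ B) (hz : ‖z‖ < 1)
    (he : ‖e‖ = 1) (hF : ∀ b ∈ F, ‖b‖ = 1) {s : ℝ} (hs : 0 < s)
    (hsep : ∀ b ∈ F, s ≤ ‖e - b‖) :
    (1 - ‖z‖ ^ 2) / thickDist B e z * ‖harmonicGrad c F z‖ ≤ 4 / s * (c * F.card) := by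
  have hD := thickDist_pos (by linarith) hz he (B := B)
  have hy := one_sub_norm_sq_pos hz
  have hρ := norm_sub_pos_of_norm_lt_one hz he
  refine mul_norm_harmonicGrad_le hc (by positivity) hz hF fun b hb => ?_
  have hb0 := norm_sub_pos_of_norm_lt_one hz (hF b hb)
  rw [div_le_iff₀ hD, div_mul_eq_mul_div, div_mul_eq_mul_div, le_div_iff₀ hs]
  have htri : s ≤ ‖z - e‖ + ‖z - b‖ := by
    refine (hsep b hb).trans ?_
    have := norm_sub_le (z - b) (z - e)
    rw [sub_sub_sub_cancel_left] at this
    linarith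
  have h1 := one_sub_norm_sq_le hz (hF b hb)
  have hyD : 1 - ‖z‖ ^ 2 ≤ thickDist B e z := by
    unfold thickDist; nlinarith
  have hρD : ‖z - e‖ ≤ thickDist B e z := by
    unfold thickDist; nlinarith
  have h2 : (1 - ‖z‖ ^ 2) * ‖z - e‖ ≤ 2 * ‖z - b‖ * thickDist B e z := by gcongr
  have h3 : (1 - ‖z‖ ^ 2) * ‖z - b‖ ≤ thickDist B e z * ‖z - b‖ := by gcongr
  nlinarith [mul_le_mul_of_nonneg_left htri hy.le, mul_pos hb0 hD]

end

/-! ### Laplacian bounds for the test function -/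

section
open Finset

variable {a r c B : ℝ} {e : ℂ} {F : Finset ℂ} {t : ℝ} {z : ℂ}

theorem norm_sq_smul_add_sub_smul (α β : ℝ) (P W N : ℂ) :
    ‖α • P + W - β • N‖ ^ 2 = α ^ 2 * ‖P‖ ^ 2 + β ^ 2 * ‖N‖ ^ 2 - 2 * α * β * inner ℝ P N
      + 2 * α * inner ℝ P W - 2 * β * inner ℝ N W + ‖W‖ ^ 2 := by
  rw [norm_sub_sq_real, norm_add_sq_real, inner_add_left, inner_smul_left, inner_smul_left,
    inner_smul_right, inner_smul_right, real_inner_comm N W, norm_smul, norm_smul, mul_pow, mul_pow,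
    Real.norm_eq_abs, Real.norm_eq_abs, sq_abs, sq_abs]
  simp only [conj_trivial]
  ring

theorem testFunction_nonneg (z : ℂ) : 0 ≤ testFunction a r c B e F t z :=
  mul_nonneg (pow_nonneg (le_max_right _ _) 3) (Real.exp_nonneg _)

theorem contDiff_testFunction (ht : 0 < t) (hB : 0 < B) (he : ‖e‖ = 1) (hF : ∀ b ∈ F, ‖b‖ = 1) :
    ContDiff ℝ 2 (testFunction a r c B e F t) := by
  have hsq : ContDiff ℝ 2 fun z : ℂ => 1 - ‖z‖ ^ 2 - t :=
    (contDiff_const.sub (contDiff_norm_sq ℝ)).sub contDiff_const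
  rw [contDiff_iff_contDiffAt]
  intro z
  rcases lt_or_ge ‖z‖ 1 with hz | hz
  · have h1 : ContDiffAt ℝ 2 (fun z : ℂ => max (1 - ‖z‖ ^ 2 - t) 0 ^ 3) z :=
      (contDiff_max_zero_pow_three.comp hsq).contDiffAt
    exact h1.mul (hasJet_logWeight hB hz he hF).exp.contDiffAt
  · have : testFunction a r c B e F t =ᶠ[nhds z] fun _ => 0 := by
      have h2 : 1 - ‖z‖ ^ 2 - t < 0 := by nlinarith
      filter_upwards [hsq.continuous.continuousAt.eventually_lt continuousAt_const h2] with w hw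
      simp [testFunction, max_eq_right hw.le]
    exact contDiffAt_const.congr_of_eventuallyEq this

theorem tsupport_testFunction_subset :
    tsupport (testFunction a r c B e F t) ⊆ {z | t ≤ 1 - ‖z‖ ^ 2} := by
  refine closure_minimal (fun z hz => ?_) (isClosed_le continuous_const (by fun_prop))
  by_contra h
  have h' : 1 - ‖z‖ ^ 2 < t := not_le.1 h
  exact hz (by simp [testFunction, max_eq_right (by linarith : 1 - ‖z‖ ^ 2 - t ≤ 0)])

theorem tsupport_testFunction_subset_ball (ht : 0 < t) :
    tsupport (testFunction a r c B e F t) ⊆ Metric.ball 0 1 := fun z hz => by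
  have h : t ≤ 1 - ‖z‖ ^ 2 := tsupport_testFunction_subset hz
  rw [mem_ball_zero_iff]
  nlinarith [norm_nonneg z]

theorem hasCompactSupport_testFunction (ht : 0 < t) :
    HasCompactSupport (testFunction a r c B e F t) :=
  (isCompact_closedBall (0 : ℂ) 1).of_isClosed_subset (isClosed_tsupport _)
    ((tsupport_testFunction_subset_ball ht).trans Metric.ball_subset_closedBall)

/-- Up to the cutoff height the Laplacian of the test function vanishes. -/
theorem planeLaplacian_testFunction_of_le (hB : 0 < B) (hz : ‖z‖ < 1) (he : ‖e‖ = 1)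
    (hF : ∀ b ∈ F, ‖b‖ = 1) (ht : 1 - ‖z‖ ^ 2 ≤ t) :
    planeLaplacian (testFunction a r c B e F t) z = 0 := by
  have h0 := (hasJet_one_sub_norm_sq z).add (HasJet.const (-t))
  have hle : 1 - ‖z‖ ^ 2 + -t ≤ 0 := by linarith
  have d3 : deriv (fun x : ℝ => max x 0 ^ 3) = fun x => 3 * max x 0 ^ 2 := by
    ext x
    rw [(hasDerivAt_max_zero_pow 1 x).deriv]
    norm_num
  have d2 : deriv (fun x : ℝ => 3 * max x 0 ^ 2) = fun x => 6 * max x 0 := by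
    ext x
    rw [((hasDerivAt_max_zero_pow 0 x).const_mul 3).deriv]
    norm_num; ring
  have h1 := (h0.comp (χ := fun x => max x 0 ^ 3) contDiff_max_zero_pow_three.contDiffAt).mul
    (hasJet_logWeight (a := a) (r := r) (c := c) hB hz he hF).exp
  have := h1.lap
  simp only [d3, d2, max_eq_right hle] at this
  simp only [← sub_eq_add_neg] at this
  unfold testFunction
  rw [this]
  simp

/-- The scaled Laplacian `y² Δφ / φ`, with `y = 1 - |z|²`, in terms of lengths and inner products of the
gradients of the factors of the test function. -/
theorem sq_mul_laplacian_log_testFunction {L n : ℝ} (hB : 0 < B) (hz : ‖z‖ < 1) (he : ‖e‖ = 1)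
    (hn : n = t / (1 - ‖z‖ ^ 2 - t)) (hL : L = a + 3 * n) (ht : t < 1 - ‖z‖ ^ 2) :
    (1 - ‖z‖ ^ 2) ^ 2 *
      ((3 * (-4 / (1 - ‖z‖ ^ 2 - t) - 4 * ‖z‖ ^ 2 / (1 - ‖z‖ ^ 2 - t) ^ 2)
        + (a - 3) * (-4 / (1 - ‖z‖ ^ 2) - 4 * ‖z‖ ^ 2 / (1 - ‖z‖ ^ 2) ^ 2)
        - r * ((1 / ‖z - e‖ - 4 * B) / thickDist B e z
          - ‖thickDistGrad B e z‖ ^ 2 / thickDist B e z ^ 2))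
        + ‖(3 / (1 - ‖z‖ ^ 2 - t) + (a - 3) / (1 - ‖z‖ ^ 2)) • ((-2 : ℝ) • z) + harmonicGrad c F z
          - (r / thickDist B e z) • thickDistGrad B e z‖ ^ 2) =
      -4 * L * (1 - ‖z‖ ^ 2) - 4 * (1 - (1 - ‖z‖ ^ 2)) * (a + 6 * n + 3 * n ^ 2)
      - r * ((1 - ‖z‖ ^ 2) ^ 2 * (1 / ‖z - e‖ - 4 * B) / thickDist B e z)
      + r * ((1 - ‖z‖ ^ 2) ^ 2 * ‖thickDistGrad B e z‖ ^ 2 / thickDist B e z ^ 2)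
      + (4 * (1 - (1 - ‖z‖ ^ 2)) * L ^ 2
      + r ^ 2 * ((1 - ‖z‖ ^ 2) ^ 2 * ‖thickDistGrad B e z‖ ^ 2 / thickDist B e z ^ 2)
      - 2 * L * r * ((1 - ‖z‖ ^ 2) * inner ℝ ((-2 : ℝ) • z) (thickDistGrad B e z)
        / thickDist B e z)
      + 2 * L * (1 - ‖z‖ ^ 2) * inner ℝ ((-2 : ℝ) • z) (harmonicGrad c F z)
      - 2 * r * (1 - ‖z‖ ^ 2) * ((1 - ‖z‖ ^ 2) / thickDist B e z
        * inner ℝ (thickDistGrad B e z) (harmonicGrad c F z))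
      + (1 - ‖z‖ ^ 2) ^ 2 * ‖harmonicGrad c F z‖ ^ 2) := by
  have hD := thickDist_pos hB hz he
  have hρ := norm_sub_pos_of_norm_lt_one hz he
  have hP : ‖(-2 : ℝ) • z‖ ^ 2 = 4 * (1 - (1 - ‖z‖ ^ 2)) := by
    rw [norm_smul, mul_pow]; norm_num
  have hx : ‖z‖ ^ 2 = 1 - (1 - ‖z‖ ^ 2) := by ring
  rw [norm_sq_smul_add_sub_smul, hP]
  generalize inner ℝ ((-2 : ℝ) • z) (thickDistGrad B e z) = I
  generalize inner ℝ ((-2 : ℝ) • z) (harmonicGrad c F z) = PG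
  generalize inner ℝ (thickDistGrad B e z) (harmonicGrad c F z) = NG
  generalize ‖thickDistGrad B e z‖ ^ 2 = NN
  generalize ‖harmonicGrad c F z‖ ^ 2 = GG
  have hy := one_sub_norm_sq_pos hz
  have hyt : 0 < 1 - ‖z‖ ^ 2 - t := by linarith
  generalize hyd : 1 - ‖z‖ ^ 2 = y at *
  rw [hx]
  generalize thickDist B e z = D at *
  generalize ‖z - e‖ = ρ at *
  -- `t` is eliminated in favour of `n`
  have hn1 : y - t = y / (1 + n) := by
    have h1 : 1 + n = y / (y - t) := by rw [hn]; field_simp; ring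
    rw [h1]; field_simp
  have hn0 : 0 < 1 + n := by
    have h1 : 1 + n = y / (y - t) := by rw [hn]; field_simp; ring
    rw [h1]; positivity
  have hα : 3 / (y - t) + (a - 3) / y = L / y := by
    rw [hn1, hL]; field_simp; ring
  have hβ : 3 * (-4 / (y - t) - 4 * (1 - y) / (y - t) ^ 2)
      + (a - 3) * (-4 / y - 4 * (1 - y) / y ^ 2) =
      -4 * L / y - 4 * (1 - y) * (a + 6 * n + 3 * n ^ 2) / y ^ 2 := by
    rw [hn1, hL]; field_simp; ring
  rw [hα, hβ]
  field_simp
  ring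

/-- Above the cutoff height the test function is `exp u` with an explicit `u`, and its Laplacian is
`exp u * (Δu + |∇u|²)`. -/
theorem planeLaplacian_testFunction_of_lt (hB : 0 < B) (hz : ‖z‖ < 1) (he : ‖e‖ = 1)
    (hF : ∀ b ∈ F, ‖b‖ = 1) (ht : t < 1 - ‖z‖ ^ 2) :
    planeLaplacian (testFunction a r c B e F t) z =
      (1 - ‖z‖ ^ 2 - t) ^ 3 * Real.exp (logWeight a r c B e F z) *
      ((3 * (-4 / (1 - ‖z‖ ^ 2 - t) - 4 * ‖z‖ ^ 2 / (1 - ‖z‖ ^ 2 - t) ^ 2)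
        + (a - 3) * (-4 / (1 - ‖z‖ ^ 2) - 4 * ‖z‖ ^ 2 / (1 - ‖z‖ ^ 2) ^ 2)
        - r * ((1 / ‖z - e‖ - 4 * B) / thickDist B e z
          - ‖thickDistGrad B e z‖ ^ 2 / thickDist B e z ^ 2))
        + ‖(3 / (1 - ‖z‖ ^ 2 - t) + (a - 3) / (1 - ‖z‖ ^ 2)) • ((-2 : ℝ) • z) + harmonicGrad c F z
          - (r / thickDist B e z) • thickDistGrad B e z‖ ^ 2) := by
  have hexp : ∀ w : ℂ, t < 1 - ‖w‖ ^ 2 →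
      Real.exp (3 * Real.log (1 - ‖w‖ ^ 2 - t) + logWeight a r c B e F w) =
        (1 - ‖w‖ ^ 2 - t) ^ 3 * Real.exp (logWeight a r c B e F w) := fun w hw => by
    have h : 0 < 1 - ‖w‖ ^ 2 - t := by linarith
    rw [Real.exp_add, mul_comm (3 : ℝ), ← Real.rpow_def_of_pos h]
    norm_cast
  have hj := (hasJet_log_testFunction (a := a) (r := r) (c := c) hB hz he hF ht).exp
  rw [hexp z ht] at hj
  refine (hj.congr ?_).lap
  have hcont : ContinuousAt (fun w : ℂ => 1 - ‖w‖ ^ 2) z := by fun_prop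
  filter_upwards [continuousAt_const.eventually_lt hcont ht] with w hw
  rw [hexp w hw, testFunction, max_eq_left (by linarith)]

theorem pow_three_mul_le {x y E C X : ℝ} (hx : 0 < x) (hE : 0 ≤ E) (hC : 0 ≤ C)
    (hX : X ≤ C / x ^ 2) (hxy : x ≤ y) : x ^ 3 * E * X ≤ C * (y * E) := by
  calc x ^ 3 * E * X ≤ x ^ 3 * E * (C / x ^ 2) := by gcongr
    _ = C * (x * E) := by field_simp
    _ ≤ C * (y * E) := by gcongr

/-- Termwise bound of the scaled Laplacian of the test function. -/
theorem abs_scaled_laplacian_le {y a r n L A₁ A₂ A₃ A₄ A₅ A₆ B₂ B₃ B₄ B₅ B₆ : ℝ}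
    (hy0 : 0 ≤ y) (hy1 : y ≤ 1) (ha : 0 ≤ a) (hr : 0 ≤ r) (hn : 0 ≤ n) (hL : L = a + 3 * n)
    (h1 : |A₁| ≤ 6) (h2 : 0 ≤ A₂) (h2' : A₂ ≤ B₂ ^ 2) (h3 : |A₃| ≤ B₃) (h4 : |y * A₄| ≤ B₄)
    (h5 : |A₅| ≤ B₅) (h6 : 0 ≤ A₆) (h6' : A₆ ≤ B₆ ^ 2) :
    |-4 * L * y - 4 * (1 - y) * (a + 6 * n + 3 * n ^ 2) - r * A₁ + r * A₂
      + (4 * (1 - y) * L ^ 2 + r ^ 2 * A₂ - 2 * L * r * A₃ + 2 * L * y * A₄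
        - 2 * r * y * A₅ + A₆)| ≤
      (4 * (a + 3) + 4 * (a + 6) + 6 * r + r * B₂ ^ 2 + 4 * (a + 3) ^ 2 + r ^ 2 * B₂ ^ 2
        + 2 * (a + 3) * r * B₃ + 2 * (a + 3) * B₄ + 2 * r * B₅ + B₆ ^ 2) * (1 + n) ^ 2 := by
  set m := (1 + n) ^ 2 with hm
  have hL0 : 0 ≤ L := by rw [hL]; positivity
  have hm1 : 1 ≤ m := by rw [hm]; nlinarith
  have hLm1 : L ≤ (a + 3) * (1 + n) := by rw [hL]; nlinarith [mul_nonneg ha hn]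
  have hLm : L ≤ (a + 3) * m := by
    refine hLm1.trans ?_
    rw [hm]; gcongr; nlinarith
  have hL2 : L ^ 2 ≤ (a + 3) ^ 2 * m := by
    rw [hm, ← mul_pow]; gcongr
  have hQ0 : 0 ≤ a + 6 * n + 3 * n ^ 2 := by positivity
  have hQ : a + 6 * n + 3 * n ^ 2 ≤ (a + 6) * m := by
    have : 0 ≤ a * (2 * n + n ^ 2) := by positivity
    rw [hm]; nlinarith [sq_nonneg n]
  have hB₃ : 0 ≤ B₃ := (abs_nonneg _).trans h3
  have hB₄ : 0 ≤ B₄ := (abs_nonneg _).trans h4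
  have hB₅ : 0 ≤ B₅ := (abs_nonneg _).trans h5
  have k1 : |4 * L * y| ≤ 4 * (a + 3) * m := by
    rw [abs_of_nonneg (by positivity)]
    nlinarith [mul_le_mul_of_nonneg_left hy1 hL0]
  have k2 : |4 * (1 - y) * (a + 6 * n + 3 * n ^ 2)| ≤ 4 * (a + 6) * m := by
    rw [abs_of_nonneg (mul_nonneg (by linarith) hQ0)]
    nlinarith [mul_nonneg hy0 hQ0]
  have k3 : |r * A₁| ≤ 6 * r * m := by
    rw [abs_mul, abs_of_nonneg hr]
    nlinarith [mul_le_mul_of_nonneg_left h1 hr, mul_le_mul_of_nonneg_left hm1 hr]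
  have k4 : |r * A₂| ≤ r * B₂ ^ 2 * m := by
    rw [abs_of_nonneg (by positivity)]
    nlinarith [mul_le_mul_of_nonneg_left h2' hr,
      mul_le_mul_of_nonneg_left hm1 (mul_nonneg hr (sq_nonneg B₂))]
  have k5 : |4 * (1 - y) * L ^ 2| ≤ 4 * (a + 3) ^ 2 * m := by
    rw [abs_of_nonneg (mul_nonneg (by linarith) (sq_nonneg L))]
    nlinarith [mul_nonneg hy0 (sq_nonneg L)]
  have k6 : |r ^ 2 * A₂| ≤ r ^ 2 * B₂ ^ 2 * m := by
    rw [abs_of_nonneg (by positivity)]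
    nlinarith [mul_le_mul_of_nonneg_left h2' (sq_nonneg r),
      mul_le_mul_of_nonneg_left hm1 (mul_nonneg (sq_nonneg r) (sq_nonneg B₂))]
  have k7 : |2 * L * r * A₃| ≤ 2 * (a + 3) * r * B₃ * m := by
    rw [abs_mul, abs_of_nonneg (by positivity)]
    calc 2 * L * r * |A₃| ≤ 2 * ((a + 3) * m) * r * B₃ := by gcongr
      _ = _ := by ring
  have k8 : |2 * L * y * A₄| ≤ 2 * (a + 3) * B₄ * m := by
    rw [mul_assoc, abs_mul, abs_of_nonneg (by positivity)]
    calc 2 * L * |y * A₄| ≤ 2 * ((a + 3) * m) * B₄ := by gcongr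
      _ = _ := by ring
  have k9 : |2 * r * y * A₅| ≤ 2 * r * B₅ * m := by
    rw [abs_mul, abs_of_nonneg (by positivity)]
    calc 2 * r * y * |A₅| ≤ 2 * r * 1 * B₅ := by gcongr
      _ = 2 * r * B₅ * 1 := by ring
      _ ≤ _ := by gcongr
  have k10 : |A₆| ≤ B₆ ^ 2 * m := by
    rw [abs_of_nonneg h6]
    exact h6'.trans (le_mul_of_one_le_right (sq_nonneg _) hm1)
  rw [abs_le] at *
  constructor <;> linarith [k1.1, k1.2, k2.1, k2.2, k3.1, k3.2, k4.1, k4.2, k5.1, k5.2, k6.1, k6.2,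
    k7.1, k7.2, k8.1, k8.2, k9.1, k9.2, k10.1, k10.2]

/-- For a thick enough `thickDist` the test function is subharmonic near the unit circle, and its
Laplacian is of the order suggested by homogeneity, uniformly in the cutoff height `t`. -/
theorem exists_testFunction_bounds {ε s : ℝ} (hr : 0 ≤ r) (hc : 0 ≤ c) (hε : 0 < ε) (hε1 : ε ≤ 1)
    (har : 1 + ε ≤ a - r) (he : ‖e‖ = 1) (hF : ∀ b ∈ F, ‖b‖ = 1) (hs : 0 < s)
    (hsep : ∀ b ∈ F, s ≤ ‖e - b‖) :
    ∃ B y₀ C : ℝ, 1 ≤ B ∧ 0 < y₀ ∧ 0 ≤ C ∧ ∀ t, 0 < t → ∀ z : ℂ, ‖z‖ < 1 →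
      (1 - ‖z‖ ^ 2 ≤ y₀ → 0 ≤ planeLaplacian (testFunction a r c B e F t) z) ∧
      |planeLaplacian (testFunction a r c B e F t) z| ≤
        C * ((1 - ‖z‖ ^ 2) * Real.exp (logWeight a r c B e F z)) := by
  have ha : 0 < a := by linarith
  set B : ℝ := 1 + 2 * (2 * r + 4 * r * (a + 3)) / ε with hBdef
  have hB1 : 1 ≤ B := by rw [hBdef]; exact le_add_of_nonneg_right (by positivity)
  have hB : 0 < B := by linarith
  have hBbig : 2 * (2 * r + 4 * r * (a + 3)) ≤ B * ε := by
    rw [hBdef, add_mul, div_mul_cancel₀ _ hε.ne']; linarith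
  set cN : ℝ := c * F.card with hcN
  have hcN0 : 0 ≤ cN := by positivity
  set C₁ : ℝ := (1 + 2 * B) * (4 / s * cN) with hC₁
  have hC₁0 : 0 ≤ C₁ := by positivity
  set C₂ : ℝ := (4 + 2 * cN) * (a + 3) + 2 * r * (1 + r) + 2 * r * C₁ with hC₂
  have hC₂0 : 0 < C₂ := by positivity
  set y₀ : ℝ := min (1 / 2) (ε / (2 * C₂)) with hy₀
  set C₃ : ℝ := 4 * (a + 3) + 4 * (a + 6) + 6 * r + r * (1 + 2 * B) ^ 2 + 4 * (a + 3) ^ 2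
    + r ^ 2 * (1 + 2 * B) ^ 2 + 2 * (a + 3) * r * (2 * (1 + 2 * B)) + 2 * (a + 3) * (4 * cN)
    + 2 * r * C₁ + (2 * cN) ^ 2 with hC₃
  have hC₃0 : 0 ≤ C₃ := by positivity
  refine ⟨B, y₀, C₃, hB1, by positivity, hC₃0, fun t ht z hz => ?_⟩
  have hy := one_sub_norm_sq_pos hz
  rcases le_or_gt (1 - ‖z‖ ^ 2) t with hyt | hyt
  · rw [planeLaplacian_testFunction_of_le hB hz he hF hyt]
    refine ⟨fun _ => le_rfl, ?_⟩
    rw [abs_zero]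
    have := Real.exp_nonneg (logWeight a r c B e F z)
    positivity
  have hD := thickDist_pos hB hz he
  have hρ := norm_sub_pos_of_norm_lt_one hz he
  have hyt' : 0 < 1 - ‖z‖ ^ 2 - t := by linarith
  set n := t / (1 - ‖z‖ ^ 2 - t) with hn
  set L := a + 3 * n with hL
  have hn0 : 0 ≤ n := by positivity
  have hN := norm_thickDistGrad_le hB.le hz he
  have hkey := sq_mul_laplacian_log_testFunction (a := a) (r := r) (c := c) (F := F) hB hz he hn hL hyt
  have hNG : (1 - ‖z‖ ^ 2) / thickDist B e z
      * |inner ℝ (thickDistGrad B e z) (harmonicGrad c F z)| ≤ C₁ := by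
    have h1 := mul_norm_harmonicGrad_div_thickDist_le hc hB1 hz he hF hs hsep
    calc _ ≤ (1 - ‖z‖ ^ 2) / thickDist B e z * (‖thickDistGrad B e z‖ * ‖harmonicGrad c F z‖) := by
          gcongr; exact abs_real_inner_le_norm _ _
      _ = ‖thickDistGrad B e z‖ * ((1 - ‖z‖ ^ 2) / thickDist B e z * ‖harmonicGrad c F z‖) := by
          ring
      _ ≤ (1 + 2 * B) * (4 / s * cN) := by gcongr
  rw [planeLaplacian_testFunction_of_lt hB hz he hF hyt]
  constructor
  · intro hy0
    refine mul_nonneg (by positivity) ?_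
    refine (mul_nonneg_iff_of_pos_left (pow_pos hy 2)).1 ?_
    rw [hkey]
    refine subharmonicity_inequality hy (hy0.trans (min_le_left _ _)) hρ
      (one_sub_norm_sq_le hz he) hB rfl hr hε hε1 har hn0 hL (norm_thickDistGrad_sq hz he)
      (inner_grad_thickDistGrad hz he) hcN0 (inner_grad_harmonicGrad hc hz hF) hC₁0
      ((mul_le_mul_of_nonneg_left (le_abs_self _) (by positivity)).trans hNG)
      (sq_nonneg _) hBbig ?_
    calc (1 - ‖z‖ ^ 2) * C₂ ≤ ε / (2 * C₂) * C₂ := by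
          gcongr; exact hy0.trans (min_le_right _ _)
      _ = ε / 2 := by field_simp
  · -- the size of each term is read off after scaling by `y²`
    have hn1 : 1 + n = (1 - ‖z‖ ^ 2) / (1 - ‖z‖ ^ 2 - t) := by
      rw [hn, eq_div_iff hyt'.ne', add_mul, div_mul_cancel₀ _ hyt'.ne']; ring
    have hy1 : 1 - ‖z‖ ^ 2 ≤ 1 := by linarith [sq_nonneg ‖z‖]
    have hyρ := one_sub_norm_sq_le hz he
    have hByD : B * (1 - ‖z‖ ^ 2) ≤ thickDist B e z := by unfold thickDist; linarith
    have hyD : (1 - ‖z‖ ^ 2) / thickDist B e z ≤ 1 :=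
      (div_le_one hD).2 (le_trans (le_mul_of_one_le_left hy.le hB1) hByD)
    have hyD0 : 0 ≤ (1 - ‖z‖ ^ 2) / thickDist B e z := by positivity
    have hP : ‖(-2 : ℝ) • z‖ ≤ 2 := by
      rw [norm_smul]; norm_num; exact hz.le
    have b1 : |(1 - ‖z‖ ^ 2) ^ 2 * (1 / ‖z - e‖ - 4 * B) / thickDist B e z| ≤ 6 := by
      have e1 : (1 - ‖z‖ ^ 2) ^ 2 * (1 / ‖z - e‖ - 4 * B) / thickDist B e z =
          (1 - ‖z‖ ^ 2) / ‖z - e‖ * ((1 - ‖z‖ ^ 2) / thickDist B e z)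
          - 4 * (B * (1 - ‖z‖ ^ 2) / thickDist B e z) * (1 - ‖z‖ ^ 2) := by
        field_simp
      have h1 : (1 - ‖z‖ ^ 2) / ‖z - e‖ ≤ 2 := (div_le_iff₀ hρ).2 hyρ
      have h2 : B * (1 - ‖z‖ ^ 2) / thickDist B e z ≤ 1 := (div_le_one hD).2 hByD
      have h3 : (1 - ‖z‖ ^ 2) / ‖z - e‖ * ((1 - ‖z‖ ^ 2) / thickDist B e z) ≤ 2 * 1 := by gcongr
      have h4 : 4 * (B * (1 - ‖z‖ ^ 2) / thickDist B e z) * (1 - ‖z‖ ^ 2) ≤ 4 * 1 * 1 := by gcongr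
      have h5 : 0 ≤ (1 - ‖z‖ ^ 2) / ‖z - e‖ * ((1 - ‖z‖ ^ 2) / thickDist B e z) := by positivity
      have h6 : 0 ≤ 4 * (B * (1 - ‖z‖ ^ 2) / thickDist B e z) * (1 - ‖z‖ ^ 2) := by positivity
      rw [e1, abs_le]
      constructor <;> linarith
    have b2 : (1 - ‖z‖ ^ 2) ^ 2 * ‖thickDistGrad B e z‖ ^ 2 / thickDist B e z ^ 2
        ≤ (1 + 2 * B) ^ 2 := by
      have e1 : (1 - ‖z‖ ^ 2) ^ 2 * ‖thickDistGrad B e z‖ ^ 2 / thickDist B e z ^ 2 =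
          ((1 - ‖z‖ ^ 2) / thickDist B e z * ‖thickDistGrad B e z‖) ^ 2 := by ring
      rw [e1]
      have : (1 - ‖z‖ ^ 2) / thickDist B e z * ‖thickDistGrad B e z‖ ≤ 1 * (1 + 2 * B) := by gcongr
      rw [one_mul] at this
      gcongr
    have b2' : 0 ≤ (1 - ‖z‖ ^ 2) ^ 2 * ‖thickDistGrad B e z‖ ^ 2 / thickDist B e z ^ 2 := by
      positivity
    have b3 : |(1 - ‖z‖ ^ 2) * inner ℝ ((-2 : ℝ) • z) (thickDistGrad B e z) / thickDist B e z|
        ≤ 2 * (1 + 2 * B) := by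
      rw [mul_div_right_comm, abs_mul, abs_of_nonneg hyD0]
      calc _ ≤ 1 * (‖(-2 : ℝ) • z‖ * ‖thickDistGrad B e z‖) := by
            gcongr; exact abs_real_inner_le_norm _ _
        _ ≤ 1 * (2 * (1 + 2 * B)) := by gcongr
        _ = _ := one_mul _
    have b6 : (1 - ‖z‖ ^ 2) * ‖harmonicGrad c F z‖ ≤ 2 * cN :=
      mul_norm_harmonicGrad_le hc hy.le hz hF fun b hb => one_sub_norm_sq_le hz (hF b hb)
    have b4 : |(1 - ‖z‖ ^ 2) * inner ℝ ((-2 : ℝ) • z) (harmonicGrad c F z)| ≤ 4 * cN := by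
      rw [abs_mul, abs_of_nonneg hy.le]
      calc _ ≤ (1 - ‖z‖ ^ 2) * (‖(-2 : ℝ) • z‖ * ‖harmonicGrad c F z‖) := by
            gcongr; exact abs_real_inner_le_norm _ _
        _ = ‖(-2 : ℝ) • z‖ * ((1 - ‖z‖ ^ 2) * ‖harmonicGrad c F z‖) := by ring
        _ ≤ 2 * (2 * cN) := by gcongr
        _ = _ := by ring
    have b5 : |(1 - ‖z‖ ^ 2) / thickDist B e z
        * inner ℝ (thickDistGrad B e z) (harmonicGrad c F z)| ≤ C₁ := by
      rwa [abs_mul, abs_of_nonneg hyD0]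
    have b6' : (1 - ‖z‖ ^ 2) ^ 2 * ‖harmonicGrad c F z‖ ^ 2 ≤ (2 * cN) ^ 2 := by
      rw [← mul_pow]; gcongr
    have b6'' : 0 ≤ (1 - ‖z‖ ^ 2) ^ 2 * ‖harmonicGrad c F z‖ ^ 2 := by positivity
    have hbound := abs_scaled_laplacian_le hy.le hy1 ha.le hr hn0 hL b1 b2' b2 b3 b4 b5 b6'' b6'
    rw [← hkey, ← hC₃, abs_mul, abs_of_pos (pow_pos hy 2)] at hbound
    rw [abs_mul, abs_of_nonneg (by positivity)]
    set X := |(3 * (-4 / (1 - ‖z‖ ^ 2 - t) - 4 * ‖z‖ ^ 2 / (1 - ‖z‖ ^ 2 - t) ^ 2)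
        + (a - 3) * (-4 / (1 - ‖z‖ ^ 2) - 4 * ‖z‖ ^ 2 / (1 - ‖z‖ ^ 2) ^ 2)
        - r * ((1 / ‖z - e‖ - 4 * B) / thickDist B e z
          - ‖thickDistGrad B e z‖ ^ 2 / thickDist B e z ^ 2))
        + ‖(3 / (1 - ‖z‖ ^ 2 - t) + (a - 3) / (1 - ‖z‖ ^ 2)) • ((-2 : ℝ) • z) + harmonicGrad c F z
          - (r / thickDist B e z) • thickDistGrad B e z‖ ^ 2|
    rw [hn1] at hbound
    have hX : X ≤ C₃ / (1 - ‖z‖ ^ 2 - t) ^ 2 := by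
      have h2 : (1 - ‖z‖ ^ 2) ^ 2 * X ≤ (1 - ‖z‖ ^ 2) ^ 2 * (C₃ / (1 - ‖z‖ ^ 2 - t) ^ 2) := by
        refine hbound.trans_eq ?_
        rw [div_pow]; ring
      exact le_of_mul_le_mul_left h2 (pow_pos hy 2)
    have hE := Real.exp_nonneg (logWeight a r c B e F z)
    exact pow_three_mul_le hyt' hE hC₃0 hX (sub_le_self _ ht.le)

end

/-! ### Integrability of the model singularity -/

section
open MeasureTheory

theorem abs_div_pi_le_norm_polarCoord_symm_sub_one {p : ℝ × ℝ} (h1 : 0 < p.1)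
    (hp : p.2 ∈ Set.Ioo (-Real.pi) Real.pi) :
    |p.2| / Real.pi ≤ ‖Complex.polarCoord.symm p - 1‖ := by
  obtain ⟨r, θ⟩ := p
  simp only at h1 hp ⊢
  have hsq : ‖Complex.polarCoord.symm (r, θ) - 1‖ ^ 2 = (r - Real.cos θ) ^ 2 + Real.sin θ ^ 2 := by
    rw [Complex.polarCoord_symm_apply, ← Complex.normSq_eq_norm_sq, Complex.normSq_apply]
    simp [Complex.cos_ofReal_re, Complex.sin_ofReal_re]
    linear_combination (r ^ 2 - 1) * Real.sin_sq_add_cos_sq θ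
  refine le_of_sq_le_sq ?_ (norm_nonneg _)
  rw [hsq]
  have hpi := Real.pi_pos
  have hθ : |θ| < Real.pi := abs_lt.2 hp
  rcases le_or_gt |θ| (Real.pi / 2) with h | h
  · have h2 := Real.mul_abs_le_abs_sin h
    have h3 : |θ| / Real.pi ≤ |Real.sin θ| := by
      refine le_trans ?_ h2
      rw [div_mul_eq_mul_div]
      gcongr
      linarith [abs_nonneg θ]
    have h4 : (|θ| / Real.pi) ^ 2 ≤ |Real.sin θ| ^ 2 := by gcongr
    rw [sq_abs] at h4
    nlinarith [sq_nonneg (r - Real.cos θ)]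
  · have hc : Real.cos θ ≤ 0 := by
      rw [← Real.cos_abs]
      exact Real.cos_nonpos_of_pi_div_two_le_of_le h.le (by linarith)
    have h3 : |θ| / Real.pi ≤ 1 := (div_le_one hpi).2 hθ.le
    have h4 : (|θ| / Real.pi) ^ 2 ≤ 1 := pow_le_one₀ (by positivity) h3
    nlinarith [Real.sin_sq_add_cos_sq θ, mul_nonneg h1.le (neg_nonneg.2 hc)]

/-- The model singularity at a boundary point: `(1 - |z|²) ^ s |z - b| ^ s` is integrable over the
disc for `-1 < s ≤ 0`. -/
theorem integrableOn_rpow_mul_rpow_norm_sub {s : ℝ} (hs : -1 < s) (hs0 : s ≤ 0) {b : ℂ}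
    (hb : ‖b‖ = 1) :
    IntegrableOn (fun z : ℂ => (1 - ‖z‖ ^ 2) ^ s * ‖z - b‖ ^ s) (Metric.ball 0 1) := by
  set g : ℂ → ℂ → ℝ≥0∞ := fun b z =>
    (Metric.ball (0 : ℂ) 1).indicator (fun z => ENNReal.ofReal ((1 - ‖z‖ ^ 2) ^ s * ‖z - b‖ ^ s)) z
    with hg
  have hmeas : ∀ b : ℂ, Measurable fun z : ℂ => (1 - ‖z‖ ^ 2) ^ s * ‖z - b‖ ^ s := fun b =>
    ((measurable_const.sub (measurable_norm.pow_const 2)).pow_const s).mul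
      ((measurable_id.sub_const b).norm.pow_const s)
  have hgm : ∀ b, Measurable (g b) := fun b =>
    (hmeas b).ennreal_ofReal.indicator measurableSet_ball
  -- a rotation moves the singularity to `1`
  have hrot : ∫⁻ z, g b z = ∫⁻ z, g 1 z := by
    set u : Circle := ⟨b, by simp [Submonoid.unitSphere, hb]⟩ with hu
    have hmp := (rotation u).measurePreserving
    rw [← hmp.lintegral_comp (hgm b)]
    refine lintegral_congr fun z => ?_
    have hbz : (rotation u) z = b * z := rfl
    have h1 : ‖b * z‖ = ‖z‖ := by rw [norm_mul, hb, one_mul]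
    have h2 : ‖b * z - b‖ = ‖z - 1‖ := by
      rw [show b * z - b = b * (z - 1) by ring, norm_mul, hb, one_mul]
    simp only [hg, Set.indicator, hbz, mem_ball_zero_iff, h1, h2]
  have hpolar : ∫⁻ z, g 1 z ≤
      (∫⁻ r in Set.Ioo (0 : ℝ) 1, ENNReal.ofReal ((1 - r) ^ s)) *
        ∫⁻ θ in Set.Ioo (-Real.pi) Real.pi, ENNReal.ofReal ((|θ| / Real.pi) ^ s) := by
    set h₁ : ℝ → ℝ≥0∞ := (Set.Ioo (0 : ℝ) 1).indicator fun r => ENNReal.ofReal ((1 - r) ^ s)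
    set h₂ : ℝ → ℝ≥0∞ := fun θ => ENNReal.ofReal ((|θ| / Real.pi) ^ s)
    have hm₁ : Measurable h₁ :=
      (((measurable_const.sub measurable_id).pow_const s).ennreal_ofReal).indicator measurableSet_Ioo
    have hm₂ : Measurable h₂ :=
      ((measurable_id.abs.div_const _).pow_const s).ennreal_ofReal
    have hle : ∀ p ∈ Set.Ioi (0 : ℝ) ×ˢ Set.Ioo (-Real.pi) Real.pi,
        p.2 ≠ 0 → ENNReal.ofReal p.1 • g 1 (Complex.polarCoord.symm p) ≤ h₁ p.1 * h₂ p.2 := by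
      intro p hp hp2
      have hp1 : 0 < p.1 := hp.1
      rcases lt_or_ge p.1 1 with h1 | h1
      · have hnorm : ‖Complex.polarCoord.symm p‖ = p.1 := by
          rw [Complex.norm_polarCoord_symm, abs_of_pos hp1]
        have hmem : Complex.polarCoord.symm p ∈ Metric.ball (0 : ℂ) 1 := by
          rw [mem_ball_zero_iff, hnorm]; exact h1
        have hge := abs_div_pi_le_norm_polarCoord_symm_sub_one hp1 hp.2
        have hθ : 0 < |p.2| / Real.pi := div_pos (abs_pos.2 hp2) Real.pi_pos
        simp only [hg, h₁, h₂]
        rw [Set.indicator_of_mem hmem, Set.indicator_of_mem (show p.1 ∈ Set.Ioo (0 : ℝ) 1 from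
          ⟨hp1, h1⟩), hnorm, smul_eq_mul, ← ENNReal.ofReal_mul hp1.le,
          ← ENNReal.ofReal_mul (Real.rpow_nonneg (by linarith) _)]
        refine ENNReal.ofReal_le_ofReal ?_
        have k1 : (1 - p.1 ^ 2) ^ s ≤ (1 - p.1) ^ s :=
          Real.rpow_le_rpow_of_nonpos (by linarith) (by nlinarith) hs0
        have k2 : ‖Complex.polarCoord.symm p - 1‖ ^ s ≤ (|p.2| / Real.pi) ^ s :=
          Real.rpow_le_rpow_of_nonpos hθ hge hs0
        have k3 : 0 ≤ (1 - p.1) ^ s := Real.rpow_nonneg (by linarith) _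
        have k4 : 0 ≤ (1 - p.1 ^ 2) ^ s := Real.rpow_nonneg (by nlinarith) _
        calc p.1 * ((1 - p.1 ^ 2) ^ s * ‖Complex.polarCoord.symm p - 1‖ ^ s)
            ≤ 1 * ((1 - p.1) ^ s * (|p.2| / Real.pi) ^ s) := by gcongr
          _ = _ := one_mul _
      · have hmem : Complex.polarCoord.symm p ∉ Metric.ball (0 : ℂ) 1 := by
          rw [mem_ball_zero_iff, Complex.norm_polarCoord_symm, abs_of_pos hp1]
          exact not_lt.2 h1
        simp only [hg]
        rw [Set.indicator_of_notMem hmem]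
        simp
    -- the ray `θ = 0`, on which the bound is lost, is a null set
    have hnull : ∀ᵐ p : ℝ × ℝ, p.2 ≠ 0 := by
      rw [Measure.volume_eq_prod]
      exact Measure.quasiMeasurePreserving_snd.ae (Measure.ae_ne volume (0 : ℝ))
    rw [← Complex.lintegral_comp_polarCoord_symm, polarCoord_target]
    calc _ ≤ ∫⁻ p in Set.Ioi (0 : ℝ) ×ˢ Set.Ioo (-Real.pi) Real.pi, h₁ p.1 * h₂ p.2 := by
          refine lintegral_mono_ae ?_
          filter_upwards [ae_restrict_mem (measurableSet_Ioi.prod measurableSet_Ioo),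
            ae_restrict_of_ae hnull] with p h1 h2
          exact hle p h1 h2
      _ = (∫⁻ r in Set.Ioi (0 : ℝ), h₁ r) * ∫⁻ θ in Set.Ioo (-Real.pi) Real.pi, h₂ θ := by
          rw [Measure.volume_eq_prod, ← Measure.prod_restrict,
            lintegral_prod_mul hm₁.aemeasurable hm₂.aemeasurable]
      _ ≤ _ := by
          refine mul_le_mul' ?_ le_rfl
          rw [← lintegral_indicator measurableSet_Ioo]
          exact setLIntegral_le_lintegral _ _
  have hfin1 : ∫⁻ r in Set.Ioo (0 : ℝ) 1, ENNReal.ofReal ((1 - r) ^ s) < ∞ := by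
    have h1 := (intervalIntegral.intervalIntegrable_rpow' (a := 1) (b := 0) hs).comp_sub_left 1
    rw [sub_self, sub_zero, intervalIntegrable_iff_integrableOn_Ioo_of_le zero_le_one] at h1
    exact h1.lintegral_lt_top
  have hfin2 : ∫⁻ θ in Set.Ioo (-Real.pi) Real.pi, ENNReal.ofReal ((|θ| / Real.pi) ^ s) < ∞ := by
    have hpos : IntervalIntegrable (fun θ : ℝ => |θ| ^ s) volume 0 Real.pi := by
      refine (intervalIntegral.intervalIntegrable_rpow' (a := 0) (b := Real.pi) hs).congr ?_
      intro θ hθ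
      rw [Set.uIoc_of_le Real.pi_pos.le] at hθ
      simp [abs_of_pos hθ.1]
    have hneg : IntervalIntegrable (fun θ : ℝ => |θ| ^ s) volume (-Real.pi) 0 := by
      have := (hpos.comp_sub_left 0).symm
      simpa using this
    have h1 := (hneg.trans hpos).mul_const (Real.pi ^ s)⁻¹
    rw [intervalIntegrable_iff_integrableOn_Ioo_of_le (by linarith [Real.pi_pos])] at h1
    have h2 : (fun θ : ℝ => |θ| ^ s * (Real.pi ^ s)⁻¹) = fun θ => (|θ| / Real.pi) ^ s := by
      ext θ; rw [Real.div_rpow (abs_nonneg _) Real.pi_pos.le]; rfl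
    rw [h2] at h1
    exact h1.lintegral_lt_top
  refine ⟨(hmeas b).aestronglyMeasurable, ?_⟩
  rw [hasFiniteIntegral_iff_ofReal]
  · rw [← lintegral_indicator measurableSet_ball]
    exact (hrot.trans_le hpolar).trans_lt (ENNReal.mul_lt_top hfin1 hfin2)
  · filter_upwards [ae_restrict_mem measurableSet_ball] with z hz
    have := one_sub_norm_sq_pos (mem_ball_zero_iff.1 hz)
    positivity

end

/-! ### Comparison with the integrable majorant -/

section
open Finset

variable {a r c B : ℝ} {e : ℂ} {F : Finset ℂ} {z : ℂ}

theorem exp_logWeight (hB : 0 < B) (hz : ‖z‖ < 1) (he : ‖e‖ = 1) (hF : ∀ b ∈ F, ‖b‖ = 1) :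
    Real.exp (logWeight a r c B e F z) =
      (1 - ‖z‖ ^ 2) ^ (a - 3) * (∏ b ∈ F, ‖z - b‖ ^ c) * thickDist B e z ^ (-r) := by
  rw [logWeight, Real.exp_add, Real.exp_add, mul_sum, Real.exp_sum,
    Real.rpow_def_of_pos (one_sub_norm_sq_pos hz), Real.rpow_def_of_pos (thickDist_pos hB hz he),
    mul_comm (a - 3), mul_comm (-r)]
  congr 2
  refine prod_congr rfl fun b hb => ?_
  rw [Real.rpow_def_of_pos (norm_sub_pos_of_norm_lt_one hz (hF b hb)), mul_comm]

theorem norm_sub_le_two (hz : ‖z‖ < 1) (he : ‖e‖ = 1) : ‖z - e‖ ≤ 2 :=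
  (norm_sub_le z e).trans (by linarith)

/-- The product of the distances to the points of `F` is controlled by any one of its factors. -/
theorem prod_rpow_norm_sub_le (hc : 0 ≤ c) (hz : ‖z‖ < 1) (hF : ∀ b ∈ F, ‖b‖ = 1) {b₀ : ℂ}
    (hb₀ : b₀ ∈ F) : ∏ b ∈ F, ‖z - b‖ ^ c ≤ (2 ^ c) ^ F.card * ‖z - b₀‖ ^ c := by
  classical
  have h2 : (1 : ℝ) ≤ 2 ^ c := Real.one_le_rpow one_le_two hc
  rw [← mul_prod_erase F _ hb₀, mul_comm]
  gcongr
  calc ∏ b ∈ F.erase b₀, ‖z - b‖ ^ c ≤ ∏ b ∈ F.erase b₀, (2 : ℝ) ^ c := by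
        refine prod_le_prod (fun b _ => by positivity) fun b hb => ?_
        exact Real.rpow_le_rpow (norm_nonneg _) (norm_sub_le_two hz (hF b (mem_of_mem_erase hb))) hc
    _ = (2 ^ c) ^ (F.erase b₀).card := by rw [prod_const]
    _ ≤ (2 ^ c) ^ F.card := pow_le_pow_right₀ h2 (card_le_card (erase_subset _ _))

/-- Conversely the distance to a finite set is controlled by the product of the distances to its
points, since at most one of them can be small. -/
theorem exists_infDist_le_mul_prod (F : Finset ℂ) (hF : F.Nonempty) :
    ∃ C : ℝ, 0 < C ∧ ∀ z, Metric.infDist z F ≤ C * ∏ b ∈ F, ‖z - b‖ := by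
  classical
  induction hF using Finset.Nonempty.cons_induction with
  | singleton b => exact ⟨1, one_pos, fun z => by simp [dist_eq_norm]⟩
  | cons b s hb hs ih =>
    obtain ⟨C, hC, h⟩ := ih
    have hclosed : IsClosed (s : Set ℂ) := s.finite_toSet.isClosed
    have hd : 0 < Metric.infDist b s :=
      (hclosed.notMem_iff_infDist_pos (by exact_mod_cast hs)).1 (by exact_mod_cast hb)
    refine ⟨2 / Metric.infDist b s * max C 1 * max C 1, by positivity, fun z => ?_⟩
    rw [prod_cons]
    set P := ∏ b ∈ s, ‖z - b‖ with hP
    have hP0 : 0 ≤ P := by positivity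
    set I := Metric.infDist z (Finset.cons b s hb : Finset ℂ) with hI
    have hI0 : 0 ≤ I := Metric.infDist_nonneg
    have h1 : I ≤ ‖z - b‖ := by
      rw [← dist_eq_norm]; exact Metric.infDist_le_dist_of_mem (by simp)
    have h2 : I ≤ Metric.infDist z s := Metric.infDist_le_infDist_of_subset (by
      intro x hx; simp only [coe_cons, Set.mem_insert_iff]; exact Or.inr hx) (by exact_mod_cast hs)
    have h3 : Metric.infDist b s ≤ ‖z - b‖ + Metric.infDist z s := by
      have := Metric.infDist_le_infDist_add_dist (s := (s : Set ℂ)) (x := b) (y := z)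
      rw [dist_comm, dist_eq_norm] at this
      linarith
    have h4 : Metric.infDist z s ≤ max C 1 * P :=
      (h z).trans (mul_le_mul_of_nonneg_right (le_max_left _ _) hP0)
    have hm : 1 ≤ max C 1 := le_max_right _ _
    have hd0 : 0 ≤ Metric.infDist z s := Metric.infDist_nonneg
    -- one of the two distances is at least half of the gap, and `I` is at most the other one
    have h5 : I * Metric.infDist b s ≤ 2 * (‖z - b‖ * Metric.infDist z s) := by
      have k1 : I * ‖z - b‖ ≤ Metric.infDist z s * ‖z - b‖ := by gcongr
      have k2 : I * Metric.infDist z s ≤ ‖z - b‖ * Metric.infDist z s := by gcongr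
      nlinarith [mul_le_mul_of_nonneg_left h3 hI0]
    have h6 : I ≤ 2 / Metric.infDist b s * (‖z - b‖ * Metric.infDist z s) := by
      rw [div_mul_eq_mul_div, le_div_iff₀ hd]; exact h5
    calc I ≤ 2 / Metric.infDist b s * (‖z - b‖ * Metric.infDist z s) := h6
      _ ≤ 2 / Metric.infDist b s * (‖z - b‖ * (max C 1 * P)) := by gcongr
      _ = 2 / Metric.infDist b s * max C 1 * 1 * (‖z - b‖ * P) := by ring
      _ ≤ 2 / Metric.infDist b s * max C 1 * max C 1 * (‖z - b‖ * P) := by gcongr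

/-- The integrable majorant: a sum of model singularities at the points of `F`. -/
noncomputable def singularMajorant (s : ℝ) (F : Finset ℂ) (z : ℂ) : ℝ :=
  ∑ b ∈ F, (1 - ‖z‖ ^ 2) ^ s * ‖z - b‖ ^ s

theorem integrableOn_singularMajorant {s : ℝ} (hs : -1 < s) (hs0 : s ≤ 0)
    (hF : ∀ b ∈ F, ‖b‖ = 1) :
    MeasureTheory.IntegrableOn (singularMajorant s F) (Metric.ball 0 1) :=
  MeasureTheory.integrable_finsetSum _ fun b hb =>
    integrableOn_rpow_mul_rpow_norm_sub hs hs0 (hF b hb)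

theorem le_singularMajorant {s : ℝ} (hz : ‖z‖ < 1) {b : ℂ} (hb : b ∈ F) :
    (1 - ‖z‖ ^ 2) ^ s * ‖z - b‖ ^ s ≤ singularMajorant s F z := by
  have hy := one_sub_norm_sq_pos hz
  exact single_le_sum (f := fun b => (1 - ‖z‖ ^ 2) ^ s * ‖z - b‖ ^ s)
    (fun b _ => by positivity) hb

theorem le_thickDist (hB : 1 ≤ B) (hz : ‖z‖ < 1) :
    ‖z - e‖ ≤ thickDist B e z ∧ 1 - ‖z‖ ^ 2 ≤ thickDist B e z := by
  have hy := one_sub_norm_sq_pos hz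
  unfold thickDist
  constructor <;> nlinarith [norm_nonneg (z - e)]

theorem thickDist_le (hB : 0 ≤ B) (hz : ‖z‖ < 1) (he : ‖e‖ = 1) :
    thickDist B e z ≤ (1 + 2 * B) * ‖z - e‖ := by
  have := one_sub_norm_sq_le hz he
  unfold thickDist
  nlinarith

/-- The Laplacian bound of the test function is integrable. -/
theorem mul_exp_logWeight_le {p ε : ℝ} (hr : 0 ≤ r) (hrp : r ≤ p) (hc : 0 ≤ c) (hε1 : ε ≤ 1)
    (ha : a = p + 1 + ε) (hB : 1 ≤ B) (hz : ‖z‖ < 1) (he : ‖e‖ = 1) (hF : ∀ b ∈ F, ‖b‖ = 1)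
    (hF0 : F.Nonempty) :
    (1 - ‖z‖ ^ 2) * Real.exp (logWeight a r c B e F z) ≤
      (2 ^ c) ^ F.card * 2 ^ c * 2 ^ (1 - ε) * singularMajorant (ε - 1) F z := by
  obtain ⟨b, hb⟩ := hF0
  have hy := one_sub_norm_sq_pos hz
  have hy1 : 1 - ‖z‖ ^ 2 ≤ 1 := by linarith [sq_nonneg ‖z‖]
  have hρ := norm_sub_pos_of_norm_lt_one hz (hF b hb)
  have hD := thickDist_pos (by linarith) hz he (B := B)
  have k1 : thickDist B e z ^ (-r) ≤ (1 - ‖z‖ ^ 2) ^ (-r) :=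
    Real.rpow_le_rpow_of_nonpos hy (le_thickDist hB hz).2 (by linarith)
  have k2 := prod_rpow_norm_sub_le hc hz hF hb
  have k3 : ‖z - b‖ ^ c ≤ 2 ^ c :=
    Real.rpow_le_rpow (norm_nonneg _) (norm_sub_le_two hz (hF b hb)) hc
  have k4 : (1 : ℝ) ≤ 2 ^ (1 - ε) * ‖z - b‖ ^ (ε - 1) := by
    have := Real.rpow_le_rpow_of_nonpos hρ (norm_sub_le_two hz (hF b hb))
      (by linarith : ε - 1 ≤ 0)
    calc (1 : ℝ) = 2 ^ (1 - ε) * 2 ^ (ε - 1) := by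
          rw [← Real.rpow_add two_pos]; simp
      _ ≤ _ := by gcongr
  have k5 : (1 - ‖z‖ ^ 2) * (1 - ‖z‖ ^ 2) ^ (a - 3) * (1 - ‖z‖ ^ 2) ^ (-r) ≤
      (1 - ‖z‖ ^ 2) ^ (ε - 1) := by
    have : (1 - ‖z‖ ^ 2) * (1 - ‖z‖ ^ 2) ^ (a - 3) * (1 - ‖z‖ ^ 2) ^ (-r) =
        (1 - ‖z‖ ^ 2) ^ (1 + (a - 3) + -r) := by
      rw [Real.rpow_add hy, Real.rpow_add hy, Real.rpow_one]
    rw [this]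
    exact Real.rpow_le_rpow_of_exponent_ge hy hy1 (by rw [ha]; linarith)
  rw [exp_logWeight (by linarith) hz he hF]
  calc (1 - ‖z‖ ^ 2) * ((1 - ‖z‖ ^ 2) ^ (a - 3) * (∏ b ∈ F, ‖z - b‖ ^ c) * thickDist B e z ^ (-r))
      ≤ (1 - ‖z‖ ^ 2) * ((1 - ‖z‖ ^ 2) ^ (a - 3) * ((2 ^ c) ^ F.card * 2 ^ c)
          * (1 - ‖z‖ ^ 2) ^ (-r)) := by
        have := k2.trans (mul_le_mul_of_nonneg_left k3 (by positivity))
        gcongr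
    _ = ((1 - ‖z‖ ^ 2) * (1 - ‖z‖ ^ 2) ^ (a - 3) * (1 - ‖z‖ ^ 2) ^ (-r))
          * ((2 ^ c) ^ F.card * 2 ^ c) := by ring
    _ ≤ (1 - ‖z‖ ^ 2) ^ (ε - 1) * ((2 ^ c) ^ F.card * 2 ^ c) := by gcongr
    _ = (1 - ‖z‖ ^ 2) ^ (ε - 1) * ((2 ^ c) ^ F.card * 2 ^ c) * 1 := (mul_one _).symm
    _ ≤ (1 - ‖z‖ ^ 2) ^ (ε - 1) * ((2 ^ c) ^ F.card * 2 ^ c)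
          * (2 ^ (1 - ε) * ‖z - b‖ ^ (ε - 1)) := by gcongr
    _ = (2 ^ c) ^ F.card * 2 ^ c * 2 ^ (1 - ε)
          * ((1 - ‖z‖ ^ 2) ^ (ε - 1) * ‖z - b‖ ^ (ε - 1)) := by ring
    _ ≤ _ := by
        have := le_singularMajorant (s := ε - 1) hz hb
        gcongr

/-- The growth bound times the Laplacian bound of the test function is integrable: the exponents of
the test function are chosen for this. -/
theorem growth_mul_exp_logWeight_le {p q ε : ℝ} (hr : 0 ≤ r) (hrp : r ≤ p)
    (hc : 0 ≤ c) (hcq : q - 1 + ε ≤ c)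
    (ha : a = p + 1 + ε) (hB : 1 ≤ B) (hz : ‖z‖ < 1) (he : ‖e‖ = 1) (hF : ∀ b ∈ F, ‖b‖ = 1)
    (hF0 : F.Nonempty) :
    1 / (1 - ‖z‖) ^ p * (‖z - e‖ ^ r / Metric.infDist z F ^ q)
        * ((1 - ‖z‖ ^ 2) * Real.exp (logWeight a r c B e F z)) ≤
      2 ^ p * ((2 ^ c) ^ F.card * 2 ^ (c - q - (ε - 1))) * singularMajorant (ε - 1) F z := by
  have hy := one_sub_norm_sq_pos hz
  have hp : 0 ≤ p := hr.trans hrp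
  have hD := thickDist_pos (by linarith) hz he (B := B)
  obtain ⟨b, hb, hdist⟩ := (F.finite_toSet.isCompact).exists_infDist_eq_dist
    (by exact_mod_cast hF0) z
  have hb' : b ∈ F := by exact_mod_cast hb
  rw [dist_eq_norm] at hdist
  have hρ := norm_sub_pos_of_norm_lt_one hz (hF b hb')
  have hz' : 0 < 1 - ‖z‖ := by linarith
  have k1 : (1 - ‖z‖ ^ 2) * (1 - ‖z‖ ^ 2) ^ (a - 3) / (1 - ‖z‖) ^ p ≤
      2 ^ p * (1 - ‖z‖ ^ 2) ^ (ε - 1) := by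
    have e1 : (1 - ‖z‖ ^ 2) * (1 - ‖z‖ ^ 2) ^ (a - 3) =
        (1 - ‖z‖ ^ 2) ^ p * (1 - ‖z‖ ^ 2) ^ (ε - 1) := by
      rw [← Real.rpow_add hy, ← Real.rpow_one (1 - ‖z‖ ^ 2)]
      rw [← Real.rpow_mul hy.le, ← Real.rpow_mul hy.le, ← Real.rpow_add hy, ha]
      congr 1; ring
    have e2 : (1 - ‖z‖ ^ 2) ^ p ≤ 2 ^ p * (1 - ‖z‖) ^ p := by
      rw [← Real.mul_rpow two_pos.le hz'.le]
      exact Real.rpow_le_rpow hy.le (by nlinarith [norm_nonneg z]) hp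
    rw [e1, div_le_iff₀ (by positivity)]
    calc _ ≤ 2 ^ p * (1 - ‖z‖) ^ p * (1 - ‖z‖ ^ 2) ^ (ε - 1) := by gcongr
      _ = _ := by ring
  have k2 : ‖z - e‖ ^ r * thickDist B e z ^ (-r) ≤ 1 := by
    rw [Real.rpow_neg hD.le, ← div_eq_mul_inv, div_le_one (by positivity)]
    exact Real.rpow_le_rpow (norm_nonneg _) (le_thickDist hB hz).1 hr
  have k3 : (∏ b ∈ F, ‖z - b‖ ^ c) / ‖z - b‖ ^ q ≤
      (2 ^ c) ^ F.card * 2 ^ (c - q - (ε - 1)) * ‖z - b‖ ^ (ε - 1) := by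
    rw [div_le_iff₀ (by positivity)]
    refine (prod_rpow_norm_sub_le hc hz hF hb').trans ?_
    have e1 : ‖z - b‖ ^ c = ‖z - b‖ ^ (c - q - (ε - 1)) * ‖z - b‖ ^ (ε - 1) * ‖z - b‖ ^ q := by
      rw [← Real.rpow_add hρ, ← Real.rpow_add hρ]; congr 1; ring
    have e2 : ‖z - b‖ ^ (c - q - (ε - 1)) ≤ 2 ^ (c - q - (ε - 1)) :=
      Real.rpow_le_rpow hρ.le (norm_sub_le_two hz (hF b hb')) (by linarith)
    rw [e1]
    calc _ ≤ (2 ^ c) ^ F.card * (2 ^ (c - q - (ε - 1)) * ‖z - b‖ ^ (ε - 1) * ‖z - b‖ ^ q) := by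
          gcongr
      _ = _ := by ring
  rw [exp_logWeight (by linarith) hz he hF, hdist]
  have hprod : 0 ≤ ∏ b ∈ F, ‖z - b‖ ^ c := prod_nonneg fun b _ => by positivity
  calc _ = ((1 - ‖z‖ ^ 2) * (1 - ‖z‖ ^ 2) ^ (a - 3) / (1 - ‖z‖) ^ p)
        * (‖z - e‖ ^ r * thickDist B e z ^ (-r)) * ((∏ b ∈ F, ‖z - b‖ ^ c) / ‖z - b‖ ^ q) := by
        ring
    _ ≤ (2 ^ p * (1 - ‖z‖ ^ 2) ^ (ε - 1)) * 1
        * ((2 ^ c) ^ F.card * 2 ^ (c - q - (ε - 1)) * ‖z - b‖ ^ (ε - 1)) := by gcongr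
    _ = 2 ^ p * ((2 ^ c) ^ F.card * 2 ^ (c - q - (ε - 1)))
        * ((1 - ‖z‖ ^ 2) ^ (ε - 1) * ‖z - b‖ ^ (ε - 1)) := by ring
    _ ≤ _ := by
        have := le_singularMajorant (s := ε - 1) hz hb'
        gcongr

end

/-! ### The estimate for a single point of `E` -/

section
open Finset MeasureTheory

variable {a r c B : ℝ} {e : ℂ} {F : Finset ℂ} {z : ℂ}

theorem measurable_logWeight : Measurable (logWeight a r c B e F) := by
  have hy : Measurable fun z : ℂ => 1 - ‖z‖ ^ 2 := measurable_const.sub (measurable_norm.pow_const 2)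
  have h1 : ∀ b : ℂ, Measurable fun z : ℂ => ‖z - b‖ := fun b => (measurable_id.sub_const b).norm
  refine ((hy.log.const_mul _).add ?_).add ?_
  · exact (Finset.measurable_fun_sum F fun b _ => (h1 b).log).const_mul c
  · exact (((h1 e).add (hy.const_mul B)).log).const_mul (-r)

/-- A cutoff height below which all points of a finite subset of the disc lie. -/
theorem exists_cutoff {S : Finset ℂ} (hS : ∀ z ∈ S, ‖z‖ < 1) :
    ∃ t : ℝ, 0 < t ∧ ∀ z ∈ S, t ≤ (1 - ‖z‖ ^ 2) / 2 := by
  have h : ∀ᶠ t : ℝ in nhdsWithin 0 (Set.Ioi 0), ∀ z ∈ S, t ≤ (1 - ‖z‖ ^ 2) / 2 := by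
    rw [Filter.eventually_all_finset]
    intro z hz
    have := one_sub_norm_sq_pos (hS z hz)
    exact nhdsWithin_le_nhds (Iic_mem_nhds (half_pos this))
  obtain ⟨t, h1, h2⟩ := (h.and self_mem_nhdsWithin).exists
  exact ⟨t, h2, h1⟩

/-- Away from the cutoff the test function is comparable to the weight it is made from. -/
theorem le_testFunction {t : ℝ} (ha : 0 ≤ a) (hr : 0 ≤ r) (hB : 1 ≤ B) (hz : ‖z‖ < 1)
    (he : ‖e‖ = 1) (hF : ∀ b ∈ F, ‖b‖ = 1) (ht : t ≤ (1 - ‖z‖ ^ 2) / 2) :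
    (1 - ‖z‖) ^ a * (∏ b ∈ F, ‖z - b‖ ^ c) * ‖z - e‖ ^ (-r) ≤
      8 * (1 + 2 * B) ^ r * testFunction a r c B e F t z := by
  have hy := one_sub_norm_sq_pos hz
  have hD := thickDist_pos (by linarith) hz he (B := B)
  have hρ := norm_sub_pos_of_norm_lt_one hz he
  have hprod : 0 ≤ ∏ b ∈ F, ‖z - b‖ ^ c := prod_nonneg fun b _ => by positivity
  have k1 : (1 - ‖z‖) ^ a ≤ (1 - ‖z‖ ^ 2) ^ a :=
    Real.rpow_le_rpow (by linarith) (by nlinarith [norm_nonneg z]) ha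
  have k2 : ‖z - e‖ ^ (-r) ≤ (1 + 2 * B) ^ r * thickDist B e z ^ (-r) := by
    have h1 : ((1 + 2 * B) * ‖z - e‖) ^ (-r) ≤ thickDist B e z ^ (-r) :=
      Real.rpow_le_rpow_of_nonpos hD (thickDist_le (by linarith) hz he) (by linarith)
    rw [Real.mul_rpow (by linarith) hρ.le] at h1
    calc ‖z - e‖ ^ (-r) = (1 + 2 * B) ^ r * ((1 + 2 * B) ^ (-r) * ‖z - e‖ ^ (-r)) := by
          rw [← mul_assoc, ← Real.rpow_add (by linarith), add_neg_cancel, Real.rpow_zero, one_mul]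
      _ ≤ _ := by gcongr
  have k3 : (1 - ‖z‖ ^ 2) ^ a = (1 - ‖z‖ ^ 2) ^ 3 * (1 - ‖z‖ ^ 2) ^ (a - 3) := by
    rw [← Real.rpow_natCast (1 - ‖z‖ ^ 2) 3, ← Real.rpow_add hy]; congr 1; push_cast; ring
  have k4 : (1 - ‖z‖ ^ 2) ^ 3 ≤ 8 * max (1 - ‖z‖ ^ 2 - t) 0 ^ 3 := by
    have : (1 - ‖z‖ ^ 2) / 2 ≤ max (1 - ‖z‖ ^ 2 - t) 0 := le_max_of_le_left (by linarith)
    calc (1 - ‖z‖ ^ 2) ^ 3 = 8 * ((1 - ‖z‖ ^ 2) / 2) ^ 3 := by ring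
      _ ≤ _ := by gcongr
  rw [testFunction, exp_logWeight (by linarith) hz he hF]
  calc _ ≤ (8 * max (1 - ‖z‖ ^ 2 - t) 0 ^ 3 * (1 - ‖z‖ ^ 2) ^ (a - 3))
        * (∏ b ∈ F, ‖z - b‖ ^ c) * ((1 + 2 * B) ^ r * thickDist B e z ^ (-r)) := by
        have := k1.trans (k3.trans_le (mul_le_mul_of_nonneg_right k4 (by positivity)))
        gcongr
    _ = _ := by ring

/-- The Blaschke-type estimate for a single point `e` at which the growth bound vanishes, for finite
sets of zeros, and with the distance to `F` replaced by a product. -/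
theorem exists_sum_zeros_le {p q ε : ℝ} (hr : 0 ≤ r) (hrp : r ≤ p) (hc : 0 ≤ c)
    (hcq : q - 1 + ε ≤ c) (hε : 0 < ε) (hε1 : ε ≤ 1) (he : ‖e‖ = 1) (hF : ∀ b ∈ F, ‖b‖ = 1)
    (hF0 : F.Nonempty) (heF : e ∉ F) :
    ∃ C : ℝ, 0 ≤ C ∧ ∀ K : ℝ, 0 < K → ∀ f : ℂ → ℂ, AnalyticOnNhd ℂ f (Metric.ball 0 1) →
      ‖f 0‖ = 1 →
      (∀ z ∈ Metric.ball (0 : ℂ) 1, Real.log ‖f z‖ ≤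
        K / (1 - ‖z‖) ^ p * (‖z - e‖ ^ r / Metric.infDist z F ^ q)) →
      ∀ (S : Finset ℂ) (m : ℂ → ℕ),
        (∀ z ∈ S, ‖z‖ < 1 ∧ analyticOrderAt f z = (m z + 1 : ℕ)) →
        ∑ z ∈ S, ((m z : ℝ) + 1) *
          ((1 - ‖z‖) ^ (p + 1 + ε) * (∏ b ∈ F, ‖z - b‖ ^ c) * ‖z - e‖ ^ (-r)) ≤ C * K := by
  set a := p + 1 + ε with ha
  have ha0 : 0 ≤ a := by linarith
  have hclosed : IsClosed (F : Set ℂ) := F.finite_toSet.isClosed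
  have hs : 0 < Metric.infDist e F :=
    (hclosed.notMem_iff_infDist_pos (by exact_mod_cast hF0)).1 (by exact_mod_cast heF)
  have hsep : ∀ b ∈ F, Metric.infDist e F ≤ ‖e - b‖ := fun b hb => by
    rw [← dist_eq_norm]; exact Metric.infDist_le_dist_of_mem (by exact_mod_cast hb)
  obtain ⟨B, y₀, C₁, hB, hy₀, hC₁, hbounds⟩ := exists_testFunction_bounds (a := a) hr hc hε hε1
    (by linarith) he hF hs hsep
  have hB0 : 0 < B := by linarith
  -- `G` bounds the Laplacian of the test functions, up to a constant
  set G : ℂ → ℝ := fun z => (1 - ‖z‖ ^ 2) * Real.exp (logWeight a r c B e F z) with hG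
  have hGm : Measurable G :=
    (measurable_const.sub (measurable_norm.pow_const 2)).mul measurable_logWeight.exp
  have hGpos : ∀ z : ℂ, ‖z‖ < 1 → 0 < G z := fun z hz =>
    mul_pos (one_sub_norm_sq_pos hz) (Real.exp_pos _)
  set R : ℝ := Real.sqrt (1 - min y₀ 1) with hR
  have hy₁ : 0 < min y₀ 1 := lt_min hy₀ one_pos
  have hR1 : R < 1 := by
    rw [hR, Real.sqrt_lt' one_pos]; linarith
  have hRy : ∀ z : ℂ, R < ‖z‖ → 1 - ‖z‖ ^ 2 ≤ y₀ := fun z hz => by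
    have h1 : 1 - min y₀ 1 < ‖z‖ ^ 2 := (Real.sqrt_lt' ((Real.sqrt_nonneg _).trans_lt hz)).1 hz
    linarith [min_le_left y₀ 1]
  have hball : ∀ {z : ℂ}, z ∈ Metric.closedBall (0 : ℂ) R → ‖z‖ < 1 := fun {z} hz =>
    (mem_closedBall_zero_iff.1 hz).trans_lt hR1
  -- on the compact core `G` is bounded above and below
  have hGcont : ContinuousOn G (Metric.closedBall 0 R) := fun z hz => by
    have h1 : ContinuousAt (logWeight a r c B e F) z :=
      (hasJet_logWeight hB0 (hball hz) he hF).contDiffAt.continuousAt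
    exact ((by fun_prop : ContinuousAt (fun z : ℂ => 1 - ‖z‖ ^ 2) z).mul
      h1.rexp).continuousWithinAt
  have hne : (Metric.closedBall (0 : ℂ) R).Nonempty :=
    ⟨0, Metric.mem_closedBall_self (Real.sqrt_nonneg _)⟩
  obtain ⟨z₁, hz₁, hmax⟩ := (isCompact_closedBall (0 : ℂ) R).exists_isMaxOn hne hGcont
  obtain ⟨z₂, hz₂, hmin⟩ := (isCompact_closedBall (0 : ℂ) R).exists_isMinOn hne hGcont
  have hG₁ := hGpos z₁ (hball hz₁)
  have hG₂ := hGpos z₂ (hball hz₂)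
  set C₀ := C₁ * G z₁ with hC₀
  have hC₀0 : 0 ≤ C₀ := by positivity
  set C₂ := C₁ + C₀ / G z₂ with hC₂
  have hC₂0 : 0 ≤ C₂ := by positivity
  -- integrability
  set J := singularMajorant (ε - 1) F with hJ
  have hJi : IntegrableOn J (Metric.ball 0 1) :=
    integrableOn_singularMajorant (by linarith) (by linarith) hF
  set C₃ : ℝ := (2 ^ c) ^ F.card * 2 ^ c * 2 ^ (1 - ε) with hC₃
  set C₄ : ℝ := 2 ^ p * ((2 ^ c) ^ F.card * 2 ^ (c - q - (ε - 1))) with hC₄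
  have hJ0 : 0 ≤ ∫ z in Metric.ball (0 : ℂ) 1, J z := by
    refine setIntegral_nonneg measurableSet_ball fun z hz => ?_
    have := one_sub_norm_sq_pos (mem_ball_zero_iff.1 hz)
    exact sum_nonneg fun b _ => by positivity
  set C₅ : ℝ := C₂ * C₄ * ∫ z in Metric.ball (0 : ℂ) 1, J z with hC₅
  have hC₅0 : 0 ≤ C₅ := by positivity
  refine ⟨8 * (1 + 2 * B) ^ r * C₅, by positivity, fun K hK f hf hf0 hlog S m hS => ?_⟩
  set M : ℂ → ℝ := fun z => K / (1 - ‖z‖) ^ p * (‖z - e‖ ^ r / Metric.infDist z F ^ q) with hM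
  have hMm : Measurable M := by
    have h1 : Measurable fun z : ℂ => 1 - ‖z‖ := measurable_const.sub measurable_norm
    have h2 : Measurable fun z : ℂ => ‖z - e‖ := (measurable_id.sub_const e).norm
    have h3 : Measurable fun z : ℂ => Metric.infDist z F := (Metric.continuous_infDist_pt _).measurable
    exact (measurable_const.div (h1.pow_const p)).mul ((h2.pow_const r).div (h3.pow_const q))
  have hM0 : ∀ z ∈ Metric.ball (0 : ℂ) 1, 0 ≤ M z := fun z hz => by
    have h1 : 0 ≤ 1 - ‖z‖ := by linarith [mem_ball_zero_iff.1 hz]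
    have h2 : 0 ≤ Metric.infDist z F := Metric.infDist_nonneg
    simp only [hM]
    positivity
  have hGle : ∀ z ∈ Metric.ball (0 : ℂ) 1, G z ≤ C₃ * J z := fun z hz =>
    mul_exp_logWeight_le hr hrp hc hε1 ha hB (mem_ball_zero_iff.1 hz) he hF hF0
  have hMGle : ∀ z ∈ Metric.ball (0 : ℂ) 1, M z * G z ≤ K * (C₄ * J z) := fun z hz => by
    have := growth_mul_exp_logWeight_le hr hrp hc hcq ha hB (mem_ball_zero_iff.1 hz) he hF hF0
    calc M z * G z = K * (1 / (1 - ‖z‖) ^ p * (‖z - e‖ ^ r / Metric.infDist z F ^ q) * G z) := by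
          simp only [hM]; ring
      _ ≤ _ := mul_le_mul_of_nonneg_left this hK.le
  have hGi : IntegrableOn G (Metric.ball 0 1) := by
    refine Integrable.mono' (hJi.const_mul C₃) hGm.aestronglyMeasurable ?_
    filter_upwards [ae_restrict_mem measurableSet_ball] with z hz
    rw [Real.norm_of_nonneg (hGpos z (mem_ball_zero_iff.1 hz)).le]
    exact hGle z hz
  have hMGi : IntegrableOn (fun z => M z * G z) (Metric.ball 0 1) := by
    refine Integrable.mono' ((hJi.const_mul C₄).const_mul K)
      (hMm.mul hGm).aestronglyMeasurable ?_
    filter_upwards [ae_restrict_mem measurableSet_ball] with z hz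
    rw [Real.norm_of_nonneg (mul_nonneg (hM0 z hz) (hGpos z (mem_ball_zero_iff.1 hz)).le)]
    exact hMGle z hz
  have hMWi : IntegrableOn (fun z => M z * (C₂ * G z)) (Metric.ball 0 1) := by
    have := hMGi.const_mul C₂
    refine this.congr (.of_forall fun z => ?_)
    simp only; ring
  obtain ⟨t, ht, htS⟩ := exists_cutoff fun z hz => (hS z hz).1
  set φ := testFunction a r c B e F t with hφ
  have hφc : ContDiff ℝ 2 φ := contDiff_testFunction ht hB0 he hF
  have hφs : HasCompactSupport φ := hasCompactSupport_testFunction ht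
  have hφb : tsupport φ ⊆ Metric.ball 0 1 := tsupport_testFunction_subset_ball ht
  have hlap : ∀ z : ℂ, ‖z‖ < 1 → |planeLaplacian φ z| ≤ C₁ * G z := fun z hz =>
    (hbounds t ht z hz).2
  have hcore : ∀ z ∈ Metric.closedBall (0 : ℂ) R, |planeLaplacian φ z| ≤ C₀ := fun z hz =>
    (hlap z (hball hz)).trans (mul_le_mul_of_nonneg_left (hmax hz) hC₁)
  have hgreen : ∀ d, 0 < d → ∫ z, smoothLog f d z * planeLaplacian φ z ≤
      (∫ z in Metric.ball (0 : ℂ) 1, M z * (C₂ * G z))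
        + (∫ z in Metric.ball (0 : ℂ) 1, C₂ * G z) * d ^ 2 := fun d hd => by
    refine integral_smoothLog_mul_planeLaplacian_le hf hf0 hφc hφs hφb hM0 hlog hR1 hC₀0
      (fun z hz => (abs_le.1 (hcore z hz)).1)
      (fun z hz hRz => (hbounds t ht z (mem_ball_zero_iff.1 hz)).1 (hRy z hRz))
      (fun z hz => ?_) (fun z hz => ?_) (hGi.const_mul C₂) hMWi hd
    · refine (hlap z (mem_ball_zero_iff.1 hz)).trans ?_
      have := (hGpos z (mem_ball_zero_iff.1 hz)).le
      gcongr
      exact le_add_of_nonneg_right (by positivity)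
    · have h1 := hlap z (hball hz)
      have h2 : C₀ ≤ C₀ / G z₂ * G z := by
        rw [div_mul_eq_mul_div, le_div_iff₀ hG₂]
        exact mul_le_mul_of_nonneg_left (hmin hz) hC₀0
      rw [hC₂, add_mul]
      exact add_le_add h1 h2
  have hriesz := sum_zeros_le_of_integral_smoothLog_le hφc hφs (fun z => testFunction_nonneg z)
    (fun z hz => hf z (hφb hz)) S m
    (fun z hz => ⟨hf z (mem_ball_zero_iff.2 (hS z hz).1), (hS z hz).2⟩) hgreen
  have hint : ∫ z in Metric.ball (0 : ℂ) 1, M z * (C₂ * G z) ≤ C₅ * K := by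
    calc _ ≤ ∫ z in Metric.ball (0 : ℂ) 1, C₂ * (K * (C₄ * J z)) := by
          refine setIntegral_mono_on hMWi (((hJi.const_mul C₄).const_mul K).const_mul C₂)
            measurableSet_ball fun z hz => ?_
          calc M z * (C₂ * G z) = C₂ * (M z * G z) := by ring
            _ ≤ _ := mul_le_mul_of_nonneg_left (hMGle z hz) hC₂0
      _ = C₅ * K := by
          rw [integral_const_mul, integral_const_mul, integral_const_mul, hC₅]; ring
  have hpi : (1 : ℝ) ≤ 2 * Real.pi := by linarith [Real.pi_gt_three]
  calc _ ≤ ∑ z ∈ S, 8 * (1 + 2 * B) ^ r * (2 * Real.pi * (m z + 1) * φ z) := by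
        refine sum_le_sum fun z hz => ?_
        have h1 := le_testFunction (c := c) ha0 hr hB (hS z hz).1 he hF (htS z hz)
        have h2 : 0 ≤ φ z := testFunction_nonneg z
        have h3 : (0 : ℝ) ≤ m z + 1 := by positivity
        calc _ ≤ ((m z : ℝ) + 1) * (8 * (1 + 2 * B) ^ r * φ z) :=
              mul_le_mul_of_nonneg_left h1 h3
          _ = 8 * (1 + 2 * B) ^ r * (1 * (m z + 1) * φ z) := by ring
          _ ≤ _ := by gcongr
    _ = 8 * (1 + 2 * B) ^ r * ∑ z ∈ S, 2 * Real.pi * (m z + 1) * φ z := by rw [mul_sum]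
    _ ≤ 8 * (1 + 2 * B) ^ r * (C₅ * K) := by
        have := hriesz.trans hint
        gcongr
    _ = _ := by ring

end

/-! ### Several points of `E`, and infinite sums -/

section
open Finset

variable {E F : Finset ℂ} {z : ℂ}

/-- The weight in the theorem is bounded by a sum over the points of `E` of weights with a single
singular point, in which the distance to `F` is replaced by a product and `ε` by a smaller
number. -/
theorem exists_weight_le_sum {a a' x c r : ℝ} (haa : a' ≤ a) (hc : 0 ≤ c) (hcx : c ≤ x)
    (hF0 : F.Nonempty) (hE0 : E.Nonempty) (hF : ∀ b ∈ F, ‖b‖ = 1) :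
    ∃ C : ℝ, 0 < C ∧ ∀ z : ℂ, ‖z‖ < 1 →
      (1 - ‖z‖) ^ a * (Metric.infDist z F ^ x / Metric.infDist z E ^ r) ≤
        C * ∑ e ∈ E, (1 - ‖z‖) ^ a' * (∏ b ∈ F, ‖z - b‖ ^ c) * ‖z - e‖ ^ (-r) := by
  obtain ⟨A, hA, hAF⟩ := exists_infDist_le_mul_prod F hF0
  refine ⟨2 ^ (x - c) * A ^ c, by positivity, fun z hz => ?_⟩
  have hz' : 0 < 1 - ‖z‖ := by linarith
  have hFz : 0 < Metric.infDist z F := by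
    refine (F.finite_toSet.isClosed.notMem_iff_infDist_pos (by exact_mod_cast hF0)).1 fun h => ?_
    exact hz.ne (hF z (by exact_mod_cast h))
  obtain ⟨e, he, hdist⟩ := (E.finite_toSet.isCompact).exists_infDist_eq_dist
    (by exact_mod_cast hE0) z
  obtain ⟨b, hb⟩ := hF0
  have hF2 : Metric.infDist z F ≤ 2 :=
    (Metric.infDist_le_dist_of_mem (by exact_mod_cast hb)).trans
      (by rw [dist_eq_norm]; exact norm_sub_le_two hz (hF b hb))
  have k1 : (1 - ‖z‖) ^ a ≤ (1 - ‖z‖) ^ a' :=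
    Real.rpow_le_rpow_of_exponent_ge hz' (by linarith [norm_nonneg z]) haa
  have k2 : Metric.infDist z F ^ x ≤ 2 ^ (x - c) * (A ^ c * ∏ b ∈ F, ‖z - b‖ ^ c) := by
    calc Metric.infDist z F ^ x = Metric.infDist z F ^ (x - c) * Metric.infDist z F ^ c := by
          rw [← Real.rpow_add hFz]; congr 1; ring
      _ ≤ 2 ^ (x - c) * (A * ∏ b ∈ F, ‖z - b‖) ^ c := by
          have h1 := Real.rpow_le_rpow hFz.le hF2 (by linarith : 0 ≤ x - c)
          have h2 := Real.rpow_le_rpow hFz.le (hAF z) hc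
          gcongr
      _ = _ := by
          rw [Real.mul_rpow hA.le (prod_nonneg fun b _ => norm_nonneg _),
            Real.finsetProd_rpow _ _ fun b _ => norm_nonneg _]
  have hprod : 0 ≤ ∏ b ∈ F, ‖z - b‖ ^ c := prod_nonneg fun b _ => by positivity
  have k3 : (1 - ‖z‖) ^ a' * (∏ b ∈ F, ‖z - b‖ ^ c) * ‖z - e‖ ^ (-r) ≤
      ∑ e ∈ E, (1 - ‖z‖) ^ a' * (∏ b ∈ F, ‖z - b‖ ^ c) * ‖z - e‖ ^ (-r) :=
    single_le_sum (f := fun e => (1 - ‖z‖) ^ a' * (∏ b ∈ F, ‖z - b‖ ^ c) * ‖z - e‖ ^ (-r))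
      (fun e _ => by positivity) (by exact_mod_cast he)
  rw [hdist, dist_eq_norm, div_eq_mul_inv, ← Real.rpow_neg (norm_nonneg _)]
  calc _ ≤ (1 - ‖z‖) ^ a' * (2 ^ (x - c) * (A ^ c * ∏ b ∈ F, ‖z - b‖ ^ c) * ‖z - e‖ ^ (-r)) := by
        gcongr
    _ = 2 ^ (x - c) * A ^ c * ((1 - ‖z‖) ^ a' * (∏ b ∈ F, ‖z - b‖ ^ c) * ‖z - e‖ ^ (-r)) := by
        ring
    _ ≤ _ := by gcongr

/-- Zeros of an analytic function on the disc that does not vanish at the origin have finite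
positive order. -/
theorem analyticOrderAt_eq_add_one {f : ℂ → ℂ} (hf : AnalyticOnNhd ℂ f (Metric.ball 0 1))
    (hf0 : f 0 ≠ 0) (hz : z ∈ diskZeros f) :
    analyticOrderAt f z = (((analyticOrderAt f z).toNat - 1 : ℕ) + 1 : ℕ) := by
  have h0 : (0 : ℂ) ∈ Metric.ball (0 : ℂ) 1 := Metric.mem_ball_self one_pos
  have h1 : analyticOrderAt f z ≠ ⊤ :=
    hf.analyticOrderAt_ne_top_of_isPreconnected (convex_ball 0 1).isPreconnected h0 hz.1
      (by rw [(hf 0 h0).analyticOrderAt_eq_zero.2 hf0]; simp)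
  have h2 : analyticOrderAt f z ≠ 0 := (hf z hz.1).analyticOrderAt_ne_zero.2 hz.2
  have h3 : (analyticOrderAt f z).toNat ≠ 0 := by
    simp [ENat.toNat_eq_zero, h1, h2]
  rw [Nat.sub_add_cancel (Nat.one_le_iff_ne_zero.2 h3), ENat.natCast_toNat h1]

/-- A sum over the zeros is bounded as soon as its finite partial sums are. -/
theorem sumOverZeros_le_ofReal {f : ℂ → ℂ} (hf : AnalyticOnNhd ℂ f (Metric.ball 0 1))
    (hf0 : f 0 ≠ 0) {w : ℂ → ℝ} (hw : ∀ z, ‖z‖ < 1 → 0 ≤ w z) {C : ℝ}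
    (h : ∀ (S : Finset ℂ) (m : ℂ → ℕ),
      (∀ z ∈ S, ‖z‖ < 1 ∧ analyticOrderAt f z = (m z + 1 : ℕ)) →
        ∑ z ∈ S, ((m z : ℝ) + 1) * w z ≤ C) :
    sumOverZeros f w ≤ ENNReal.ofReal C := by
  rw [sumOverZeros, ENNReal.tsum_eq_iSup_sum]
  refine iSup_le fun T => ?_
  set m : ℂ → ℕ := fun z => (analyticOrderAt f z).toNat - 1 with hm
  have horder : ∀ z ∈ diskZeros f, analyticOrderAt f z = (m z + 1 : ℕ) := fun z hz =>
    analyticOrderAt_eq_add_one hf hf0 hz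
  have hS : ∀ z ∈ T.map (Function.Embedding.subtype _),
      ‖z‖ < 1 ∧ analyticOrderAt f z = (m z + 1 : ℕ) := fun z hz => by
    obtain ⟨ζ, -, rfl⟩ := mem_map.1 hz
    exact ⟨mem_ball_zero_iff.1 ζ.2.1, horder _ ζ.2⟩
  have hle := h _ m hS
  rw [sum_map] at hle
  refine le_trans (le_of_eq ?_) (ENNReal.ofReal_le_ofReal hle)
  rw [ENNReal.ofReal_sum_of_nonneg fun ζ _ =>
    mul_nonneg (by positivity) (hw _ (mem_ball_zero_iff.1 ζ.2.1))]
  refine sum_congr rfl fun ζ _ => ?_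
  have h1 : ((m ζ : ℝ) + 1) = ((m ζ + 1 : ℕ) : ℝ) := by push_cast; rfl
  simp only [Function.Embedding.subtype_apply]
  rw [horder _ ζ.2, h1, ENNReal.ofReal_mul (by positivity), ENNReal.ofReal_natCast]
  rfl

end

theorem theorem0p1 (E F : Set ℂ) (hE : E.Finite) (hF : F.Finite)
    (hE0 : E.Nonempty) (hF0 : F.Nonempty)
    (hET : E ⊆ Metric.sphere (0 : ℂ) 1) (hFT : F ⊆ Metric.sphere (0 : ℂ) 1)
    (hEF : Disjoint E F)
    (p q r : ℝ) (hp : 0 ≤ p) (hq : 0 ≤ q) (hr : 0 ≤ r) (ε : ℝ) (hε : 0 < ε) :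
    ∃ C : ℝ, 0 < C ∧
      ∀ K : ℝ, 0 < K →
      ∀ f : ℂ → ℂ, AnalyticOnNhd ℂ f (Metric.ball (0 : ℂ) 1) → ‖f 0‖ = 1 →
        (∀ z ∈ Metric.ball (0 : ℂ) 1,
          Real.log ‖f z‖ ≤
            K / (1 - ‖z‖) ^ p * (Metric.infDist z E ^ r / Metric.infDist z F ^ q)) →
        sumOverZeros f (fun ζ =>
            (1 - ‖ζ‖) ^ (p + 1 + ε) *
              (Metric.infDist ζ F ^ max (q - 1 + ε) 0 / Metric.infDist ζ E ^ min p r))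
          ≤ ENNReal.ofReal (C * K) := by
  lift E to Finset ℂ using hE
  lift F to Finset ℂ using hF
  have hE0' : E.Nonempty := by exact_mod_cast hE0
  have hF0' : F.Nonempty := by exact_mod_cast hF0
  have hE1 : ∀ e ∈ E, ‖e‖ = 1 := fun e he => mem_sphere_zero_iff_norm.1 (hET he)
  have hF1 : ∀ b ∈ F, ‖b‖ = 1 := fun b hb => mem_sphere_zero_iff_norm.1 (hFT hb)
  have hmin : 0 ≤ min p r := le_min hp hr
  have hε' : 0 < min ε 1 := lt_min hε one_pos
  have hle : min ε 1 ≤ ε := min_le_left _ _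
  -- the estimate for each point of `E`, with `ε` and `r` lowered to `min ε 1` and `min p r`
  have hsingle := fun e : E => exists_sum_zeros_le (p := p) (q := q) (e := e.1) (F := F) hmin
    (min_le_left p r) (le_max_right (q - 1 + min ε 1) 0) (le_max_left _ _) hε' (min_le_right _ _)
    (hE1 _ e.2) hF1 hF0' (fun h => Set.disjoint_left.1 hEF e.2 h)
  choose D hD0 hD using hsingle
  obtain ⟨A, hA, hAw⟩ := exists_weight_le_sum (E := E) (F := F) (a := p + 1 + ε)
    (a' := p + 1 + min ε 1) (x := max (q - 1 + ε) 0) (r := min p r) (by linarith)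
    (le_max_right (q - 1 + min ε 1) 0) (max_le_max_right 0 (by linarith)) hF0' hE0' hF1
  have hsum : 0 ≤ ∑ e, D e := Finset.sum_nonneg fun e _ => hD0 e
  set κ : ℝ := 2 ^ (r - min p r) with hκ
  have hκ0 : 0 < κ := by positivity
  refine ⟨1 + A * ((∑ e, D e) * κ), by positivity, fun K hK f hf hf0 hlog => ?_⟩
  have hf0' : f 0 ≠ 0 := fun h => by simp [h] at hf0
  refine sumOverZeros_le_ofReal hf hf0' (fun z hz => ?_) fun S m hS => ?_
  · have h1 : 0 ≤ 1 - ‖z‖ := by linarith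
    have h2 : 0 ≤ Metric.infDist z (F : Set ℂ) := Metric.infDist_nonneg
    have h3 : 0 ≤ Metric.infDist z (E : Set ℂ) := Metric.infDist_nonneg
    positivity
  -- the growth bound in terms of the distance to a single point of `E`
  have hgrowth : ∀ e : E, ∀ z ∈ Metric.ball (0 : ℂ) 1, Real.log ‖f z‖ ≤
      (K * κ) / (1 - ‖z‖) ^ p * (‖z - e‖ ^ min p r / Metric.infDist z F ^ q) := fun e z hz => by
    have hz1 : ‖z‖ < 1 := mem_ball_zero_iff.1 hz
    have h1 : 0 < 1 - ‖z‖ := by linarith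
    have h2 : 0 ≤ Metric.infDist z (F : Set ℂ) := Metric.infDist_nonneg
    have hρ := norm_sub_pos_of_norm_lt_one hz1 (hE1 _ e.2)
    have h3 : Metric.infDist z (E : Set ℂ) ^ r ≤ κ * ‖z - e‖ ^ min p r := by
      calc Metric.infDist z (E : Set ℂ) ^ r ≤ ‖z - e‖ ^ r := by
            refine Real.rpow_le_rpow Metric.infDist_nonneg ?_ hr
            rw [← dist_eq_norm]; exact Metric.infDist_le_dist_of_mem e.2
        _ = ‖z - e‖ ^ (r - min p r) * ‖z - e‖ ^ min p r := by
            rw [← Real.rpow_add hρ]; congr 1; ring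
        _ ≤ _ := by
            have := Real.rpow_le_rpow hρ.le (norm_sub_le_two hz1 (hE1 _ e.2))
              (sub_nonneg.2 (min_le_right p r))
            gcongr
    calc Real.log ‖f z‖ ≤ _ := hlog z hz
      _ ≤ K / (1 - ‖z‖) ^ p * (κ * ‖z - e‖ ^ min p r / Metric.infDist z F ^ q) := by gcongr
      _ = _ := by ring
  calc _ ≤ ∑ z ∈ S, ((m z : ℝ) + 1) * (A * ∑ e ∈ E, (1 - ‖z‖) ^ (p + 1 + min ε 1) *
          (∏ b ∈ F, ‖z - b‖ ^ max (q - 1 + min ε 1) 0) * ‖z - e‖ ^ (-min p r)) :=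
        Finset.sum_le_sum fun z hz => mul_le_mul_of_nonneg_left (hAw z (hS z hz).1) (by positivity)
    _ = A * ∑ e ∈ E, ∑ z ∈ S, ((m z : ℝ) + 1) * ((1 - ‖z‖) ^ (p + 1 + min ε 1) *
          (∏ b ∈ F, ‖z - b‖ ^ max (q - 1 + min ε 1) 0) * ‖z - e‖ ^ (-min p r)) := by
        rw [Finset.sum_comm, Finset.mul_sum]
        refine Finset.sum_congr rfl fun z _ => ?_
        rw [Finset.mul_sum, Finset.mul_sum, Finset.mul_sum]
        exact Finset.sum_congr rfl fun e _ => by ring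
    _ ≤ A * ∑ e, D e * (K * κ) := by
        rw [← Finset.sum_coe_sort E]
        gcongr with e
        exact hD e (K * κ) (by positivity) f hf hf0 (hgrowth e) S m hS
    _ = A * ((∑ e, D e) * κ) * K := by rw [← Finset.sum_mul]; ring
    _ ≤ (1 + A * ((∑ e, D e) * κ)) * K := by gcongr; linarith
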